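/- Let $m,n,q\ge 0$ be integers, $B_0=\{1,\overline 1,\dots,m,\overline m\}$, $B_1=\{1^\circ,\dots,n^\circ\}$, and order $B_0\cup B_1$ by $1<\overline 1<2<\overline 2<\cdots<m<\overline m<1^\circ<\cdots<n^\circ$. **Tableaux.** An *spo-tableau* of shape $\lambda$ is a filling of the Young diagram of $\lambda$ with letters of $B_0\cup B_1$ such that the boxes with letters in $B_0$ form the Young diagram of a partition $\mu\subseteq\lambda$ with at most $m$ rows, on which the rows weakly increase, the columns strictly increase, and every letter $j$ or $\overline{j}$ in row $i$ satisfies $j\ge i$ (otherwise it is a *symplectic violation*), while on the remaining boxes (letters in $B_1$) the rows strictly increase and the columns weakly increase. A *semistandard* tableau has weakly increasing rows and strictly increasing columns. **Arrays.** $\mathcal A^*$ is the set of arrays $\pi=\begin{pmatrix}a_1&\cdots&a_s\\ b_1&\cdots&b_s\end{pmatrix}$ with $a_i\in\{1,\dots,q\}$, $b_i\in B_0\cup B_1$, such that $a_i\le a_{i+1}$, $b_i\ge b_{i+1}$ whenever $a_i=a_{i+1}$, and no column $\binom{a}{b}$ with $b\in B_0$ occurs more than once. A *dual Burge array* is an array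 with $a_i,b_i\in\{1,\dots,q\}$, $a_i\le a_{i+1}$, $b_i\ge b_{i+1}$ whenever $a_i=a_{i+1}$, and $a_i\ge b_i$ for all $i$. **spo-insertion $T\leftarrow x$.** Insert $x$ into the first row: if no entry $y$ of the row satisfies $y>x$ (for $x\in B_0$), respectively $y\ge x$ (for $x\in B_1$), append $x$ to the row and stop. Otherwise $x$ replaces the leftmost such $y$, and $y$ is inserted into the next row in the same way, and so on (an empty row receives the letter in a new box). However, the first time that the bumped letter $y$ would be a symplectic violation in the next row, $y$ is instead removed, $x$ is not placed, and the empty box is moved by forward slides until there is no box to its right or below it, where it is deleted. A forward slide moves the empty box, with right neighbour $x$ and lower neighbour $y$, to the right if $x<y$ or $x=y\in B_1$, and down if $y<x$ or $x=y\in B_0$ (if only one neighbour exists, it moves there). **Dual spo-correspondence.** For $\pi\in\mathcal A^*$ start with $\tilde P_0=P_0=L_0=\emptyset$. For the $k$-th column $\binom ij$ of $\pi$ let $\tilde P_k=\tilde P_{k-1}\leftarrow j$. If a box is added, $P_k$ is $P_{k-1}$ with a box containing $i$ added in the same position, and $L_k=L_{k-1}$. If a box is removed, delete the box in this position from $P_{k-1}$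 and bump its entry $x$ into the row above, where it replaces the largest entry $x'\le x$; bump $x'$ into the next row above in the same way, until an entry $a$ is bumped out of the first row; this gives $P_k$, and $L_k$ is $L_{k-1}$ with the column $\binom ia$ added on the right. After all $s$ columns let $\tilde P_\lambda=\tilde P_s$, of shape $\lambda$, let $P_\lambda^t$ be the transpose of $P_s$, and let $L$ be obtained from $L_s$ by sorting the bottom entries below equal top entries into weakly decreasing order. **Theorem.** For every $\pi\in\mathcal A^*$, the dual spo-correspondence yields a triple $(\tilde P_\lambda,P_\lambda^t,L)$ in which $\tilde P_\lambda$ is an spo-tableau of some shape $\lambda$, the recording tableau $P_s$ has the same shape $\lambda$ and its transpose $P_\lambda^t$ is a semistandard tableau of shape $\lambda^t$ with entries in $\{1,\dots,q\}$, and $L$ is a dual Burge array. Moreover, before the sorting, the columns $\binom{i_k}{j_k}$ of $L_s$ satisfy $i_k\le i_{k+1}$, and $j_k\le j_{k+1}$ whenever $i_k=i_{k+1}$. -/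

import Mathlib

namespace SpoDual

/-- The alphabet `B₀ ∪ B₁`.  Indices are 0-based: `plain i` is the letter `i+1`, `bar i` is the
letter `i+1` with a bar (together these form `B₀`), and `circ k` is `(k+1)°` (these form `B₁`). -/
inductive Letter (m n : ℕ) : Type
  | plain : Fin m → Letter m n
  | bar : Fin m → Letter m n
  | circ : Fin n → Letter m n
  deriving DecidableEq

namespace Letter

variable {m n : ℕ}

/-- The position of a letter in `1 < 1̄ < 2 < 2̄ < ⋯ < m < m̄ < 1° < ⋯ < n°`. -/
def code : Letter m n → ℕ
  | plain i => 2 * i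
  | bar i => 2 * i + 1
  | circ k => 2 * m + k

theorem code_injective : Function.Injective (code : Letter m n → ℕ) := by
  intro a b h
  cases a <;> cases b <;> simp only [code] at h <;> first
    | (congr 1; ext; omega)
    | (exfalso; omega)

/-- The order `1 < 1̄ < 2 < 2̄ < ⋯ < m < m̄ < 1° < ⋯ < n°`. -/
instance : LinearOrder (Letter m n) := LinearOrder.lift' code code_injective

/-- Whether a letter belongs to `B₀`; otherwise it belongs to `B₁`. -/
def inB0 : Letter m n → Bool
  | plain _ => true
  | bar _ => true
  | circ _ => false

/-- Whether a letter would be a symplectic violation in row `r`, where the rows are numbered from 0: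
the letter is `i` or `ī` with `i` smaller than the (1-based) number of the row. -/
def violates (r : ℕ) : Letter m n → Bool
  | plain i => decide ((i : ℕ) < r)
  | bar i => decide ((i : ℕ) < r)
  | circ _ => false

/-- `bumps x y` : when `x` is inserted into a row, it may bump the entry `y`; this means `y > x` for
`x ∈ B₀` and `y ≥ x` for `x ∈ B₁`. -/
def bumps (x y : Letter m n) : Bool :=
  if x.inB0 then decide (x < y) else decide (x ≤ y)

end Letter

/-- A filling of a diagram, given by the list of its rows from top to bottom. -/
abbrev Filling (α : Type) : Type := List (List α)

namespace Filling

/-- The entry in row `r` and column `c` (both numbered from 0), if there is such a box. -/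
def entry {α : Type} (T : Filling α) (r c : ℕ) : Option α :=
  T[r]?.bind fun row => row[c]?

/-- `T` has the shape of the Young diagram `μ`. -/
def HasShape {α : Type} (T : Filling α) (μ : YoungDiagram) : Prop :=
  T.map List.length = μ.rowLens

/-- The transpose: row `c` of the result is column `c` of `T`. -/
def transpose {α : Type} (T : Filling α) : Filling α :=
  (List.range (T.headD []).length).map fun c => T.filterMap fun row => row[c]?

end Filling

/-- `T` is a semistandard tableau of shape `μ` with entries in `{1, …, q}`. -/
def IsSemistandard (q : ℕ) (μ : YoungDiagram) (T : Filling ℕ) : Prop :=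
  T.HasShape μ ∧ ∃ S : SemistandardYoungTableau μ, ∀ r c : ℕ, (r, c) ∈ μ →
    T.entry r c = some (S r c) ∧ 1 ≤ S r c ∧ S r c ≤ q

/-- `T` is an `spo(2m,n)`-tableau of shape `lam`.  Here `mu` is the shape of the part of `T` that
is filled with letters from `B₀`. -/
def IsSpoTableau {m n : ℕ} (lam : YoungDiagram) (T : Filling (Letter m n)) : Prop :=
  T.HasShape lam ∧ ∃ mu : YoungDiagram, mu ≤ lam ∧ mu.colLen 0 ≤ m ∧
    (∀ r c x, T.entry r c = some x → ((r, c) ∈ mu ↔ x.inB0 = true)) ∧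
    -- the part with entries in `B₀` is a semistandard symplectic tableau
    (∀ r c c' x y, c < c' → T.entry r c = some x → T.entry r c' = some y →
      x.inB0 = true → y.inB0 = true → x ≤ y) ∧
    (∀ r r' c x y, r < r' → T.entry r c = some x → T.entry r' c = some y →
      x.inB0 = true → y.inB0 = true → x < y) ∧
    (∀ r c x, T.entry r c = some x → x.inB0 = true → x.violates r = false) ∧
    -- the part with entries in `B₁` has strictly increasing rows and weakly increasing columns
    (∀ r c c' x y, c < c' → T.entry r c = some x → T.entry r c' = some y →
      x.inB0 = false → y.inB0 = false → x < y) ∧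
    (∀ r r' c x y, r < r' → T.entry r c = some x → T.entry r' c = some y →
      x.inB0 = false → y.inB0 = false → x ≤ y)

/-- `π` (a list of columns, top entry first) belongs to `𝒜*`. -/
def IsDualArray {m n : ℕ} (q : ℕ) (π : List (ℕ × Letter m n)) : Prop :=
  (∀ p ∈ π, 1 ≤ p.1 ∧ p.1 ≤ q) ∧
  π.IsChain (fun p p' => p.1 ≤ p'.1 ∧ (p.1 = p'.1 → p'.2 ≤ p.2)) ∧
  ∀ (a : ℕ) (b : Letter m n), b.inB0 = true → π.count (a, b) ≤ 1

/-- `L` (a list of columns, top entry first) is a dual Burge two-line array. -/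
def IsDualBurge (q : ℕ) (L : List (ℕ × ℕ)) : Prop :=
  (∀ p ∈ L, 1 ≤ p.1 ∧ p.1 ≤ q ∧ 1 ≤ p.2 ∧ p.2 ≤ q) ∧
  L.IsChain (fun p p' => p.1 ≤ p'.1 ∧ (p.1 = p'.1 → p'.2 ≤ p.2)) ∧
  ∀ p ∈ L, p.2 ≤ p.1

/-- What an insertion does to the shape: a box is added at the end of row `r`, or the last box of
row `r` is removed (rows are numbered from 0). -/
inductive Change : Type
  | added (r : ℕ) : Change
  | removed (r : ℕ) : Change

/-- Jeu de taquin by forward slides.  The current row is `pre`, followed by the empty box, followed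
by `suf`; the rows below it are `rest`.  The result is the list of rows (from the current one on)
after the empty box has reached an outer corner and been deleted, and the number of rows by which
the empty box has moved down. -/
def slide {m n : ℕ} (pre suf : List (Letter m n)) (rest : Filling (Letter m n)) :
    Filling (Letter m n) × ℕ :=
  match suf, rest with
  | [], [] => (if pre = [] then [] else [pre], 0)
  | x :: suf', [] => slide (pre ++ [x]) suf' []
  | [], below :: rest' =>
    match below[pre.length]? with
    | none => (if pre = [] then below :: rest' else pre :: below :: rest', 0)
    | some y =>
      let res := slide (below.take pre.length) (below.drop (pre.length + 1)) rest'
      ((pre ++ [y]) :: res.1, res.2 + 1)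
  | x :: suf', below :: rest' =>
    match below[pre.length]? with
    | none => slide (pre ++ [x]) suf' (below :: rest')
    | some y =>
      if x < y ∨ (x = y ∧ x.inB0 = false) then
        slide (pre ++ [x]) suf' (below :: rest')
      else
        let res := slide (below.take pre.length) (below.drop (pre.length + 1)) rest'
        ((pre ++ y :: x :: suf') :: res.1, res.2 + 1)
termination_by (rest.length, suf.length)

/-- Insertion of `x` into the rows of a tableau from row `r` on.  In the current row, `x` is put at
the end if it bumps nothing.  Otherwise it bumps the leftmost entry `y` that it can bump.  If `y`
would be a symplectic violation in row `r + 1`, then `y` is removed instead (and `x` is not placed),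
and the empty box is moved to an outer corner by forward slides; otherwise `x` takes the place
of `y`, and `y` is inserted from row `r + 1` on. -/
def insertFrom {m n : ℕ} (r : ℕ) (x : Letter m n) :
    Filling (Letter m n) → Filling (Letter m n) × Change
  | [] => ([[x]], Change.added r)
  | row :: rest =>
    let pre := row.takeWhile fun y => !x.bumps y
    match row.dropWhile fun y => !x.bumps y with
    | [] => ((row ++ [x]) :: rest, Change.added r)
    | y :: suf =>
      if y.violates (r + 1) then
        let res := slide pre suf rest
        (res.1, Change.removed (r + res.2))
      else
        let res := insertFrom (r + 1) y rest
        ((pre ++ x :: suf) :: res.1, res.2)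

/-- `spo`-insertion `T ← x`, together with the change of shape. -/
def spoInsert {m n : ℕ} (T : Filling (Letter m n)) (x : Letter m n) :
    Filling (Letter m n) × Change :=
  insertFrom 0 x T

/-- Add a box with entry `i` at the end of row `r` (possibly a new last row). -/
def addBox (i : ℕ) : ℕ → Filling ℕ → Filling ℕ
  | 0, [] => [[i]]
  | 0, row :: rest => (row ++ [i]) :: rest
  | _ + 1, [] => []
  | r + 1, row :: rest => row :: addBox i r rest

/-- Bump `x` into the (increasing) row `row` from below: `x` replaces the largest entry that is less
than or equal to `x`, that is, the last one of the initial segment of such entries.  The second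
component is the entry bumped out. -/
def reverseBump (x : ℕ) (row : List ℕ) : List ℕ × ℕ :=
  let pre := row.takeWhile fun y => decide (y ≤ x)
  (pre.dropLast ++ x :: row.dropWhile fun y => decide (y ≤ x), pre.getLastD 0)

/-- Reverse dual row insertion starting with the last box of row `r`, which is deleted.  The second
component is the entry bumped out of the first row. -/
def reverseDualInsert : ℕ → Filling ℕ → Filling ℕ × ℕ
  | _, [] => ([], 0)
  | 0, row :: rest =>
    (if row.dropLast = [] then rest else row.dropLast :: rest, row.getLastD 0)
  | r + 1, row :: rest =>
    let res := reverseDualInsert r rest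
    let b := reverseBump res.2 row
    (b.1 :: res.1, b.2)

/-- The data `(P̃ₖ, Pₖ, Lₖ)` of the dual `spo`-correspondence. -/
structure State (m n : ℕ) where
  spo : Filling (Letter m n)
  recording : Filling ℕ
  arr : List (ℕ × ℕ)

/-- Processing one column of the array. -/
def step {m n : ℕ} (s : State m n) (col : ℕ × Letter m n) : State m n :=
  let ins := spoInsert s.spo col.2
  match ins.2 with
  | Change.added r => ⟨ins.1, addBox col.1 r s.recording, s.arr⟩
  | Change.removed r =>
    let res := reverseDualInsert r s.recording
    ⟨ins.1, res.1, s.arr ++ [(col.1, res.2)]⟩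

/-- The data `(P̃ₛ, Pₛ, Lₛ)` after all columns have been processed from left to right. -/
def run {m n : ℕ} (π : List (ℕ × Letter m n)) : State m n :=
  π.foldl step ⟨[], [], []⟩

/-- Rearrange a two-line array so that the top row is weakly increasing and the bottom entries below
equal top entries are weakly decreasing. -/
def resort (L : List (ℕ × ℕ)) : List (ℕ × ℕ) :=
  L.insertionSort fun p p' => p.1 < p'.1 ∨ (p.1 = p'.1 ∧ p'.2 ≤ p.2)

/-- The dual `spo`-correspondence: `π` is sent to the triple of the tableau `P̃`, the transpose of
the recording tableau `P`, and the re-sorted array `L`. -/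
def dualSpo {m n : ℕ} (π : List (ℕ × Letter m n)) :
    Filling (Letter m n) × Filling ℕ × List (ℕ × ℕ) :=
  ((run π).spo, (run π).recording.transpose, resort (run π).arr)

end SpoDual

namespace SpoDual

/-! An absent box is given a value `N` larger than every entry. A row then becomes a function on all
of ℕ, and the tableau conditions become inequalities between neighbouring values, `RowRel` and
`ColRel`. One cutoff `M` serves both kinds of tableau: `M = 2 * m` for letters coded by their
position, `M = 0` for recording tableaux. Most local checks reduce to linear arithmetic.

A single insertion keeps the letter tableau valid and adds or removes one corner
(`insertFrom_isTab`, which uses `slide_isTab` for the removals). The recording tableau follows this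
shape and stays valid by `addBox_isTab` and `reverseDualInsert_spec`. An entry bumped out of it was
recorded under a top entry no larger than the present one, which gives the Burge inequality.

Two points need more: a row must not receive the same number twice, and the bottom entries of `L`
must increase under equal top entries. Both follow from comparing consecutive insertions under one
top entry, where the letters decrease and repeat only in `B₁`. An addition following an addition
lies strictly lower (`insertFrom_added_added`). A removal is always followed by a removal strictly
higher (`insertFrom_removed_removed`). Each block therefore consists of additions moving down and
then removals moving up, and removals moving up bump out weakly increasing entries
(`reverseDualInsert_le`).

The delicate comparison is the one between removals. The second insertion must meet a violation in a
row where the first one merely bumped, and its empty box must then stop above the corner removed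
before. This is shown by comparing slide paths: the later, upper path stays weakly to the right of
the lower one (`slide_slide_le`, `slide_lt_of_insertFrom_removed`). -/

/-- The relation between neighbours in a row: entries `< M` may repeat, as may the value `N` that
stands for the absence of a box. -/
def RowRel (M N a b : ℕ) : Prop := a < b ∨ (a = b ∧ (a < M ∨ a = N))

/-- The relation between neighbours in a column: entries `≥ M` may repeat. -/
def ColRel (M a b : ℕ) : Prop := a < b ∨ (a = b ∧ M ≤ a)

/-! ### Rows and tableaux as functions with a default value. -/

section Rows

variable {α : Type} (v : α → ℕ) (M N : ℕ)

/-- The value of the entry in column `c` of a row, or `N` if there is no such box. -/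
def rowVal (l : List α) (c : ℕ) : ℕ := (l[c]?).elim N v

@[simp] theorem rowVal_nil (c : ℕ) : rowVal v N [] c = N := by simp [rowVal]

variable {v N}

theorem rowVal_of_getElem? {l : List α} {c : ℕ} {x : α} (h : l[c]? = some x) :
    rowVal v N l c = v x := by simp [rowVal, h]

theorem rowVal_of_length_le {l : List α} {c : ℕ} (h : l.length ≤ c) : rowVal v N l c = N := by
  simp [rowVal, List.getElem?_eq_none h]

theorem exists_mem_rowVal {l : List α} {c : ℕ} (h : c < l.length) :
    ∃ x ∈ l, l[c]? = some x ∧ rowVal v N l c = v x :=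
  ⟨l[c], List.getElem_mem h, by simp [h], by simp [rowVal, h]⟩

theorem rowVal_append_left {l l' : List α} {c : ℕ} (h : c < l.length) :
    rowVal v N (l ++ l') c = rowVal v N l c := by
  simp [rowVal, List.getElem?_append_left h]

theorem rowVal_append_right {l l' : List α} {c : ℕ} (h : l.length ≤ c) :
    rowVal v N (l ++ l') c = rowVal v N l' (c - l.length) := by
  simp [rowVal, List.getElem?_append_right h]

theorem rowVal_cons_zero (x : α) (l : List α) : rowVal v N (x :: l) 0 = v x := by simp [rowVal]

theorem rowVal_cons_succ (x : α) (l : List α) (c : ℕ) :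
    rowVal v N (x :: l) (c + 1) = rowVal v N l c := by simp [rowVal]

/-- Values of a row with a box inserted before column `pre.length`. -/
theorem rowVal_insert_lt {pre suf : List α} {y : α} {c : ℕ} (h : c < pre.length) :
    rowVal v N (pre ++ y :: suf) c = rowVal v N (pre ++ suf) c := by
  rw [rowVal_append_left h, rowVal_append_left h]

theorem rowVal_insert_eq {pre suf : List α} {y : α} :
    rowVal v N (pre ++ y :: suf) pre.length = v y := by
  rw [rowVal_append_right le_rfl]; simp [rowVal]

theorem rowVal_insert_gt {pre suf : List α} {y : α} {c : ℕ} (h : pre.length ≤ c) :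
    rowVal v N (pre ++ y :: suf) (c + 1) = rowVal v N (pre ++ suf) c := by
  rw [rowVal_append_right (by omega), rowVal_append_right h,
    show c + 1 - pre.length = (c - pre.length) + 1 by omega, rowVal_cons_succ]

theorem rowVal_replace {pre suf : List α} {y z : α} {c : ℕ} (h : c ≠ pre.length) :
    rowVal v N (pre ++ y :: suf) c = rowVal v N (pre ++ z :: suf) c := by
  rcases Nat.lt_or_gt_of_ne h with h | h
  · rw [rowVal_insert_lt h, rowVal_insert_lt h]
  · obtain ⟨d, rfl⟩ : ∃ d, c = d + 1 := ⟨c - 1, by omega⟩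
    rw [rowVal_insert_gt (by omega), rowVal_insert_gt (by omega)]

theorem rowVal_le {l : List α} (h : ∀ x ∈ l, v x < N) (c : ℕ) : rowVal v N l c ≤ N := by
  rcases lt_or_ge c l.length with hc | hc
  · obtain ⟨x, hx, -, e⟩ := exists_mem_rowVal (v := v) (N := N) hc
    rw [e]; exact (h x hx).le
  · rw [rowVal_of_length_le hc]

theorem rowVal_lt_iff {l : List α} (h : ∀ x ∈ l, v x < N) {c : ℕ} :
    rowVal v N l c < N ↔ c < l.length := by
  rcases lt_or_ge c l.length with hc | hc
  · obtain ⟨x, hx, -, e⟩ := exists_mem_rowVal (v := v) (N := N) hc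
    rw [e]; exact ⟨fun _ => hc, fun _ => h x hx⟩
  · rw [rowVal_of_length_le hc]; omega

variable (v N)

/-- The entries of a row are bounded by `N` and satisfy `E`, and neighbours are related. -/
def IsRow (E : ℕ → Prop) (l : List α) : Prop :=
  (∀ x ∈ l, v x < N ∧ E (v x)) ∧ ∀ c, RowRel M N (rowVal v N l c) (rowVal v N l (c + 1))

/-- `below` may be placed under the row `l`. -/
def Above (l below : List α) : Prop := ∀ c, ColRel M (rowVal v N l c) (rowVal v N below c)

/-- A tableau, whose rows are numbered from `r` on, with entries in row `k` satisfying `E k`. -/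
def IsTab (E : ℕ → ℕ → Prop) : ℕ → Filling α → Prop
  | _, [] => True
  | r, row :: rest =>
    row ≠ [] ∧ IsRow v M N (E r) row ∧ Above v M N row (rest.headD []) ∧ IsTab E (r + 1) rest

variable {v M N} {E : ℕ → ℕ → Prop}

theorem IsRow.lt {E : ℕ → Prop} {l : List α} (h : IsRow v M N E l) : ∀ x ∈ l, v x < N :=
  fun x hx => (h.1 x hx).1

theorem IsRow.val_lt {E : ℕ → Prop} {l : List α} (h : IsRow v M N E l) {c c' : ℕ} (hc : c < c') :
    RowRel M N (rowVal v N l c) (rowVal v N l c') := by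
  induction c', hc using Nat.le_induction with
  | base => exact h.2 c
  | succ k _ ih =>
    have := h.2 k
    simp only [RowRel] at *
    omega

theorem IsRow.val_le {E : ℕ → Prop} {l : List α} (h : IsRow v M N E l) {c c' : ℕ} (hc : c ≤ c') :
    rowVal v N l c ≤ rowVal v N l c' := by
  rcases hc.eq_or_lt with rfl | hc
  · exact le_rfl
  · have := h.val_lt hc
    simp only [RowRel] at this
    omega

theorem above_nil (hM : M ≤ N) {l : List α} (h : ∀ x ∈ l, v x < N) : Above v M N l [] := by
  intro c
  have := rowVal_le h c
  simp only [rowVal_nil, ColRel]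
  omega

theorem IsRow.nil {E : ℕ → Prop} : IsRow v M N E [] :=
  ⟨by simp, fun c => by rw [rowVal_nil, rowVal_nil]; exact Or.inr ⟨rfl, Or.inr rfl⟩⟩

theorem IsTab.isRow_headD {r : ℕ} {T : Filling α} (h : IsTab v M N E r T) :
    IsRow v M N (E r) (T.headD []) := by
  cases T with
  | nil => exact IsRow.nil
  | cons row rest => exact h.2.1

theorem Above.length_le {l l' : List α} (h : Above v M N l l') (hl : ∀ x ∈ l', v x < N) :
    l'.length ≤ l.length := by
  by_contra hc
  have h1 := h l.length
  rw [rowVal_of_length_le le_rfl] at h1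
  have := (rowVal_lt_iff (v := v) (N := N) hl (c := l.length)).2 (by omega)
  simp only [ColRel] at h1
  omega

theorem IsRow.of_mem {E : ℕ → Prop} {l : List α} (h : IsRow v M N E l) {c : ℕ}
    (hc : c < l.length) : rowVal v N l c < N ∧ E (rowVal v N l c) := by
  obtain ⟨x, hx, -, e⟩ := exists_mem_rowVal (v := v) (N := N) hc
  rw [e]; exact h.1 x hx

theorem IsRow.erase {E : ℕ → Prop} {pre suf : List α} {y : α}
    (h : IsRow v M N E (pre ++ y :: suf)) : IsRow v M N E (pre ++ suf) := by
  refine ⟨fun x hx => h.1 x ?_, fun c => ?_⟩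
  · rcases List.mem_append.1 hx with hx | hx <;> simp [hx]
  · rcases lt_trichotomy (c + 1) pre.length with hc | hc | hc
    · rw [← rowVal_insert_lt (y := y) (by omega), ← rowVal_insert_lt (y := y) hc]
      exact h.2 c
    · have := h.val_lt (show c < c + 1 + 1 by omega)
      rwa [rowVal_insert_lt (by omega), rowVal_insert_gt (by omega)] at this
    · have := h.2 (c + 1)
      rwa [rowVal_insert_gt (by omega), rowVal_insert_gt (by omega)] at this

theorem IsRow.eraseCol {E : ℕ → Prop} {l : List α} (h : IsRow v M N E l) (f : ℕ) :
    IsRow v M N E (l.take f ++ l.drop (f + 1)) := by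
  rcases lt_or_ge f l.length with hf | hf
  · refine IsRow.erase (y := l[f]) ?_
    simpa using h
  · simpa [List.take_of_length_le hf, List.drop_of_length_le (Nat.le_succ_of_le hf)] using h

end Rows

/-! ### Adding and removing corners of a shape. -/

section Shapes

/-- Add a box at the end of row `r` of a shape. -/
def addLen : ℕ → List ℕ → List ℕ
  | 0, [] => [1]
  | 0, a :: l => (a + 1) :: l
  | _ + 1, [] => []
  | r + 1, a :: l => a :: addLen r l

/-- Remove the last box of row `r` of a shape. -/
def removeLen : ℕ → List ℕ → List ℕ
  | _, [] => []
  | 0, a :: l => if a = 1 then l else (a - 1) :: l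
  | r + 1, a :: l => a :: removeLen r l

/-- The last box of row `r` is a corner of the shape. -/
def Removable : ℕ → List ℕ → Prop
  | _, [] => False
  | 0, a :: l => l.headD 0 < a
  | r + 1, _ :: l => Removable r l

end Shapes

/-! ### The alphabet as an initial segment of ℕ. -/

section Letters

variable {m n : ℕ}

namespace Letter

theorem code_lt (x : Letter m n) : x.code < 2 * m + n := by
  cases x <;> simp only [code] <;> omega

theorem inB0_iff (x : Letter m n) : x.inB0 = true ↔ x.code < 2 * m := by
  cases x <;> simp [code, inB0]; omega

theorem inB0_eq_false_iff (x : Letter m n) : x.inB0 = false ↔ 2 * m ≤ x.code := by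
  rw [← Bool.not_eq_true, inB0_iff, not_lt]

theorem violates_iff (r : ℕ) (x : Letter m n) :
    x.violates r = true ↔ x.code < 2 * m ∧ x.code < 2 * r := by
  cases x <;> simp [code, violates]
  all_goals omega

theorem lt_iff_code {x y : Letter m n} : x < y ↔ x.code < y.code := Iff.rfl

theorem le_iff_code {x y : Letter m n} : x ≤ y ↔ x.code ≤ y.code := Iff.rfl

theorem eq_iff_code {x y : Letter m n} : x = y ↔ x.code = y.code := code_injective.eq_iff.symm

/-- This is why insertion respects columns: whatever `x` displaces may stand directly beneath it. An
entry passed over satisfies `RowRel` towards `x`, the complementary condition. -/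
theorem bumps_iff (x y : Letter m n) : x.bumps y = true ↔ ColRel (2 * m) x.code y.code := by
  have := inB0_iff x
  unfold bumps ColRel
  split_ifs with h
  · rw [decide_eq_true_iff, lt_iff_code]; have := this.1 h; omega
  · rw [decide_eq_true_iff, le_iff_code]; have : ¬ _ := fun k => h (this.2 k); omega

end Letter

/-- The condition on a value in row `r` of not being a symplectic violation. -/
def Admissible (m r a : ℕ) : Prop := a < 2 * m → 2 * r ≤ a

/-- The values of a row of letters. -/
abbrev lval (l : List (Letter m n)) (c : ℕ) : ℕ := rowVal Letter.code (2 * m + n) l c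

/-- Tableaux of letters, with rows numbered from `r` on. -/
abbrev IsLetterTab (r : ℕ) (T : Filling (Letter m n)) : Prop :=
  IsTab Letter.code (2 * m) (2 * m + n) (Admissible m) r T

theorem lval_le (l : List (Letter m n)) (c : ℕ) : lval l c ≤ 2 * m + n :=
  rowVal_le (fun x _ => x.code_lt) c

theorem lval_lt_iff {l : List (Letter m n)} {c : ℕ} : lval l c < 2 * m + n ↔ c < l.length :=
  rowVal_lt_iff (fun x _ => x.code_lt)

/-! ### Forward slides, one row at a time. -/

/-- The empty box after `pre` in the row `pre ++ suf` moves right within this row and leaves it, or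
stops, in column `f`. -/
def ExitsAt (pre suf : List (Letter m n)) (rest : Filling (Letter m n)) (f : ℕ) : Prop :=
  pre.length ≤ f ∧ f ≤ (pre ++ suf).length ∧
    (∀ c, pre.length ≤ c → c < f →
      ColRel (2 * m) (lval (pre ++ suf) c) (lval (rest.headD []) c)) ∧
    ((lval (rest.headD []) f = 2 * m + n ∧ f = (pre ++ suf).length ∧
        slide pre suf rest = (if pre ++ suf = [] then rest else (pre ++ suf) :: rest, 0)) ∨
      ∃ below rest' y, rest = below :: rest' ∧ below[f]? = some y ∧
        RowRel (2 * m) (2 * m + n) y.code (lval (pre ++ suf) f) ∧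
        slide pre suf rest =
          (((pre ++ suf).take f ++ y :: (pre ++ suf).drop f) ::
              (slide (below.take f) (below.drop (f + 1)) rest').1,
            (slide (below.take f) (below.drop (f + 1)) rest').2 + 1))

/-- This collapses all rightward moves within a row into one exit column, so that later arguments on
slides need induction on the rows only. -/
theorem exists_exitsAt (pre suf : List (Letter m n)) (rest : Filling (Letter m n)) :
    ∃ f, ExitsAt pre suf rest f := by
  induction suf generalizing pre with
  | nil =>
    refine ⟨pre.length, le_rfl, by simp, fun c h h' => by omega, ?_⟩
    cases rest with
    | nil => left; simp [slide]
    | cons below rest' =>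
      rcases h : below[pre.length]? with _ | y
      · left
        rw [slide]
        simp [h, rowVal]
      · right
        refine ⟨below, rest', y, rfl, h, ?_, ?_⟩
        · left
          rw [List.append_nil, lval, rowVal_of_length_le le_rfl]
          exact y.code_lt
        · rw [slide]
          simp [h]
  | cons x suf ih =>
    have key : ∀ (_ : ColRel (2 * m) x.code (lval (rest.headD []) pre.length))
        (_ : slide pre (x :: suf) rest = slide (pre ++ [x]) suf rest),
        ∃ f, ExitsAt pre (x :: suf) rest f := by
      intro hC hs
      obtain ⟨f, h1, h2, h3, h4⟩ := ih (pre ++ [x])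
      simp only [List.append_assoc, List.singleton_append, List.length_append (as := pre) (bs := [x]),
        List.length_singleton] at h1 h2 h3 h4
      refine ⟨f, by omega, h2, fun c hc hc' => ?_, hs ▸ h4⟩
      rcases hc.eq_or_lt with rfl | hc
      · rw [lval, rowVal_insert_eq]
        exact hC
      · exact h3 c (by omega) hc'
    have hN : ColRel (2 * m) x.code (2 * m + n) := Or.inl x.code_lt
    cases rest with
    | nil =>
      refine key (by simpa using hN) ?_
      rw [slide]
    | cons below rest' =>
      rcases h : below[pre.length]? with _ | y
      · refine key (by simpa [rowVal, h] using hN) ?_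
        rw [slide]
        simp [h]
      · by_cases hxy : x < y ∨ (x = y ∧ x.inB0 = false)
        · refine key ?_ ?_
          · simp only [List.headD_cons, lval, rowVal_of_getElem? h]
            rwa [Letter.lt_iff_code, Letter.eq_iff_code, Letter.inB0_eq_false_iff] at hxy
          · rw [slide]
            simp [h, hxy]
        · refine ⟨pre.length, le_rfl, by simp, fun c h h' => by omega, Or.inr ?_⟩
          refine ⟨below, rest', y, rfl, h, ?_, ?_⟩
          · rw [lval, rowVal_insert_eq]
            rw [Letter.lt_iff_code, Letter.eq_iff_code, Letter.inB0_eq_false_iff] at hxy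
            unfold RowRel
            omega
          · rw [slide]
            simp [h, hxy]

/-- The values in a row after the empty box has left it in column `f`. -/
theorem lval_take_cons_drop {w : List (Letter m n)} {f : ℕ} (hf : f ≤ w.length) (y : Letter m n) :
    (∀ c < f, lval (w.take f ++ y :: w.drop f) c = lval w c) ∧
      lval (w.take f ++ y :: w.drop f) f = y.code ∧
      ∀ c, f ≤ c → lval (w.take f ++ y :: w.drop f) (c + 1) = lval w c := by
  have hl : (w.take f).length = f := by simp [hf]
  have hw := List.take_append_drop f w
  refine ⟨fun c hc => ?_, ?_, fun c hc => ?_⟩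
  · rw [lval, rowVal_insert_lt (by omega), hw]
  · have := rowVal_insert_eq (v := Letter.code) (N := 2 * m + n) (pre := w.take f)
      (suf := w.drop f) (y := y)
    rwa [hl] at this
  · rw [lval, rowVal_insert_gt (by omega), hw]

/-- The values in a row after deletion of the box in column `f`. -/
theorem lval_take_append_drop {l : List (Letter m n)} {f : ℕ} (hf : f ≤ l.length) :
    (∀ c < f, lval (l.take f ++ l.drop (f + 1)) c = lval l c) ∧
      ∀ c, f ≤ c → lval (l.take f ++ l.drop (f + 1)) c = lval l (c + 1) := by
  rcases hf.eq_or_lt with rfl | hf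
  · refine ⟨fun c hc => ?_, fun c hc => ?_⟩
    · rw [lval, rowVal_append_left (by simpa using hc), List.take_length]
    rw [lval, lval, rowVal_of_length_le (by simpa using hc), rowVal_of_length_le (by omega)]
  · have hl : (l.take f).length = f := by simp [hf.le]
    have hd : l.take f ++ l[f] :: l.drop (f + 1) = l := by simp
    refine ⟨fun c hc => ?_, fun c hc => ?_⟩
    · conv_rhs => rw [← hd, lval, rowVal_insert_lt (by omega)]
    · conv_rhs => rw [← hd, lval, rowVal_insert_gt (by omega)]

/-- Forward slides produce a tableau and remove a corner. -/
theorem slide_isTab (rest : Filling (Letter m n)) : ∀ (r : ℕ) (pre suf : List (Letter m n)),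
    IsRow Letter.code (2 * m) (2 * m + n) (Admissible m r) (pre ++ suf) →
    (∀ c < pre.length, ColRel (2 * m) (lval (pre ++ suf) c) (lval (rest.headD []) c)) →
    (∀ c, pre.length ≤ c → ColRel (2 * m) (lval (pre ++ suf) c) (lval (rest.headD []) (c + 1))) →
    (∀ c < pre.length, lval (pre ++ suf) c < lval (rest.headD []) pre.length) →
    IsLetterTab (r + 1) rest →
    IsLetterTab r (slide pre suf rest).1 ∧
      (slide pre suf rest).1.map List.length = removeLen (slide pre suf rest).2
        (((pre ++ suf).length + 1) :: rest.map List.length) ∧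
      Removable (slide pre suf rest).2 (((pre ++ suf).length + 1) :: rest.map List.length) ∧
      ∀ g : List (Letter m n),
        (∀ c < pre.length, ColRel (2 * m) (lval g c) (lval (pre ++ suf) c)) →
        (∀ c, pre.length ≤ c → ColRel (2 * m) (lval g (c + 1)) (lval (pre ++ suf) c)) →
        ColRel (2 * m) (lval g pre.length) (lval (pre ++ suf) pre.length) →
        ColRel (2 * m) (lval g pre.length) (lval (rest.headD []) pre.length) →
        Above Letter.code (2 * m) (2 * m + n) g ((slide pre suf rest).1.headD []) := by
  -- The empty box stands between `pre` and `suf`, so from index `pre.length` on, `pre ++ suf` lists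
  -- entries one column to the left of their true place; this explains the shifts by one. The clause
  -- about `g` is what the induction needs: `g` is the row above, which must still fit over the
  -- first row once that row has changed.
  induction rest with
  | nil =>
    intro r pre suf hrow _ _ _ _
    obtain ⟨f, h1, h2, h3, h4 | ⟨_, _, _, h, _⟩⟩ := exists_exitsAt pre suf []
    swap
    · simp at h
    obtain ⟨-, rfl, hs⟩ := h4
    rw [hs]
    split_ifs with hw
    · rw [hw]
      refine ⟨trivial, by simp [removeLen], by simp [Removable], fun g _ _ _ _ => ?_⟩
      exact above_nil (by omega) fun x _ => x.code_lt
    · refine ⟨⟨hw, hrow, above_nil (by omega) fun x _ => x.code_lt, trivial⟩, ?_, ?_, ?_⟩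
      · have : (pre ++ suf).length ≠ 0 := by simpa using hw
        simp only [removeLen, List.map_cons, List.map_nil]
        rw [if_neg (by omega), Nat.add_sub_cancel]
      · simp [Removable]
      · intro g g1 g2 g3 _ c
        rcases lt_trichotomy c pre.length with hc | rfl | hc
        · exact g1 c hc
        · exact g3
        · have b := hrow.val_le (Nat.sub_le c 1)
          have d := g2 (c - 1) (by omega)
          rw [Nat.sub_add_cancel (by omega)] at d
          simp only [List.headD_cons, ColRel, lval] at *
          omega
  | cons below rest' ih =>
    intro r pre suf hrow c1 c2 c3 hT
    obtain ⟨hne, hbrow, hbab, hT'⟩ := hT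
    simp only [List.headD_cons] at c1 c2 c3 ⊢
    obtain ⟨f, h1, h2, h3, ⟨hbf, hf, hs⟩ | ⟨below', rest'', y, he, hy, hR, hs⟩⟩ :=
      exists_exitsAt pre suf (below :: rest')
    · simp only [List.headD_cons] at h3 hbf
      have hlen : below.length ≤ f := by
        by_contra hc
        have := (lval_lt_iff (l := below) (c := f)).2 (by omega)
        omega
      have hb0 : below.length ≠ 0 := by simpa using hne
      have hw : pre ++ suf ≠ [] := by
        intro hw
        rw [hw] at hf
        simp only [List.length_nil] at hf
        omega
      have hwl : (pre ++ suf).length ≠ 0 := by simpa using hw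
      rw [if_neg hw] at hs
      rw [hs]
      refine ⟨⟨hw, hrow, ?_, hne, hbrow, hbab, hT'⟩, ?_, ?_, ?_⟩
      · intro c
        simp only [List.headD_cons]
        by_cases hc : c < f
        · by_cases hc' : c < pre.length
          · exact c1 c hc'
          · exact h3 c (by omega) hc
        · have := lval_le (pre ++ suf) c
          have e := rowVal_of_length_le (v := Letter.code) (N := 2 * m + n) (l := below) (c := c)
            (by omega)
          rw [e]
          simp only [ColRel, lval] at *
          omega
      · simp only [removeLen, List.map_cons]
        rw [if_neg (by omega), Nat.add_sub_cancel]
      · simp only [Removable, List.map_cons, List.headD_cons]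
        omega
      · intro g g1 g2 g3 _ c
        rcases lt_trichotomy c pre.length with hc | rfl | hc
        · exact g1 c hc
        · exact g3
        · have b := hrow.val_le (Nat.sub_le c 1)
          have d := g2 (c - 1) (by omega)
          rw [Nat.sub_add_cancel (by omega)] at d
          simp only [List.headD_cons, ColRel, lval] at *
          omega
    · obtain ⟨rfl, rfl⟩ : below = below' ∧ rest' = rest'' := by simpa using he
      simp only [List.headD_cons] at h3
      have hfb : f < below.length := by
        by_contra hc
        rw [List.getElem?_eq_none (by omega)] at hy
        simp at hy
      have hyv : lval below f = y.code := rowVal_of_getElem? hy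
      have hyN := y.code_lt
      obtain ⟨e1, e2⟩ := lval_take_append_drop hfb.le
      have hpl : (below.take f).length = f := by simp [hfb.le]
      obtain ⟨n1, n2, n3⟩ := lval_take_cons_drop h2 y
      generalize hν : (pre ++ suf).take f ++ y :: (pre ++ suf).drop f = ν at *
      have hr' : IsRow Letter.code (2 * m) (2 * m + n) (Admissible m (r + 1))
          (below.take f ++ below.drop (f + 1)) := hbrow.eraseCol f
      -- The box leaves in column `f`, and `y` rises into the gap. The slide continues from the row
      -- below with its gap at `f`; the completed row `ν` takes the part of `g` there.
      obtain ⟨i1, i2, i3, i4⟩ := ih (r + 1) (below.take f) (below.drop (f + 1)) hr'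
        (fun c hc => by rw [e1 c (by omega)]; exact hbab c)
        (fun c hc => by
          rw [e2 c (by omega)]
          exact hbab (c + 1))
        (fun c hc => by
          rw [e1 c (by omega), hpl]
          have a := hbrow.val_lt (show c < f by omega)
          have b := hbab f
          simp only [RowRel, ColRel, lval] at *
          omega) hT'
      rw [hs]
      simp only
      have hνlen : ν.length = (pre ++ suf).length + 1 := by
        rw [← hν, List.length_append, List.length_cons, List.length_take, List.length_drop]
        omega
      have hrest : below.take f ++ y :: below.drop (f + 1) = below := by
        obtain ⟨_, rfl⟩ := List.getElem?_eq_some_iff.1 hy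
        simp
      have hbl : (below.take f ++ below.drop (f + 1)).length + 1 = below.length := by
        conv_rhs => rw [← hrest]
        simp only [List.length_append, List.length_cons]
        omega
      refine ⟨⟨?_, ⟨?_, ?_⟩, i4 ν ?_ ?_ ?_ ?_, i1⟩, ?_, ?_, ?_⟩
      · intro h0
        rw [h0] at hνlen
        simp at hνlen
      · intro x hx
        refine ⟨x.code_lt, ?_⟩
        rw [← hν, List.mem_append, List.mem_cons] at hx
        rcases hx with hx | rfl | hx
        · exact (hrow.1 x (List.mem_of_mem_take hx)).2
        · have := (hbrow.1 x (List.mem_of_getElem? hy)).2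
          simp only [Admissible] at *
          omega
        · exact (hrow.1 x (List.mem_of_mem_drop hx)).2
      · intro c
        have a := hrow.2 c
        rcases lt_trichotomy (c + 1) f with hc | hc | hc
        · rw [← lval, ← lval, n1 c (by omega), n1 _ hc]; exact a
        · subst hc
          rw [← lval, ← lval, n1 c (by omega), n2]
          -- The left neighbour of `y`: if the box dropped at once, `c3` applies. Otherwise the box
          -- passed over column `c`, so the entry there may stand above `below` in column `c`, which
          -- precedes `y` in its row.
          by_cases hp : c < pre.length
          · have : c + 1 = pre.length := by omega
            have b := c3 c hp
            rw [← this] at b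
            simp only [RowRel, lval] at *
            omega
          · have b := h3 c (by omega) (by omega)
            have d := hbrow.2 c
            simp only [RowRel, ColRel, lval] at *
            omega
        · by_cases hc' : c = f
          · subst hc'
            rw [← lval, ← lval, n2, n3 c le_rfl]; exact hR
          · obtain ⟨d, rfl⟩ : ∃ d, c = d + 1 := ⟨c - 1, by omega⟩
            rw [← lval, ← lval, n3 d (by omega), n3 _ (by omega)]
            exact hrow.2 d
      · intro c hc
        rw [hpl] at hc
        rw [n1 c hc, e1 c hc]
        by_cases hp : c < pre.length
        · exact c1 c hp
        · exact h3 c (by omega) hc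
      · intro c hc
        rw [hpl] at hc
        rw [n3 c hc, e2 c hc]
        exact c2 c (by omega)
      · rw [hpl, n2, e2 f le_rfl]
        have a := c2 f h1
        simp only [RowRel, ColRel, lval] at *
        omega
      · rw [hpl, n2]
        have := hbab f
        rwa [← lval, hyv] at this
      · simp only [List.map_cons, removeLen]
        rw [i2, hνlen, hbl]
      · simp only [List.map_cons, Removable]
        rwa [hbl] at i3
      · intro g g1 g2 g3 g4 c
        simp only [List.headD_cons]
        rw [← lval, ← lval]
        rcases lt_trichotomy c f with hc | rfl | hc
        · rw [n1 c hc]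
          rcases lt_trichotomy c pre.length with hp | rfl | hp
          · exact g1 c hp
          · exact g3
          · have b := hrow.val_le (Nat.sub_le c 1)
            have d := g2 (c - 1) (by omega)
            rw [Nat.sub_add_cancel (by omega)] at d
            simp only [ColRel, lval] at *
            omega
        · rw [n2]
          rcases h1.eq_or_lt with hp | hp
          · rw [← hp] at hyv ⊢
            rwa [hyv] at g4
          · have d := g2 (c - 1) (by omega)
            have d' := c2 (c - 1) (by omega)
            rw [Nat.sub_add_cancel (by omega)] at d d'
            simp only [ColRel, lval] at *
            omega
        · obtain ⟨d, rfl⟩ : ∃ d, c = d + 1 := ⟨c - 1, by omega⟩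
          rw [n3 d (by omega)]
          exact g2 d (by omega)

/-- If two empty boxes start in consecutive rows and the lower one is moved first, then the upper
one moves down by at most as many rows. -/
theorem slide_slide_le (rest : Filling (Letter m n)) :
    ∀ (r : ℕ) (pre suf pre' suf' : List (Letter m n)),
    (∀ c, pre.length ≤ c → ColRel (2 * m) (lval (pre ++ suf) c) (lval (rest.headD []) (c + 1))) →
    IsRow Letter.code (2 * m) (2 * m + n) (Admissible m r) (pre ++ suf) →
    IsLetterTab (r + 1) rest →
    (∀ c, pre'.length ≤ c → ColRel (2 * m) (lval (pre' ++ suf') c) (lval (pre ++ suf) c)) →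
    (slide pre' suf' (slide pre suf rest).1).2 ≤ (slide pre suf rest).2 := by
  induction rest with
  | nil =>
    intro r pre suf pre' suf' _ _ _ hc
    obtain ⟨f, h1, h2, h3, h4 | ⟨_, _, _, h, _⟩⟩ := exists_exitsAt pre suf []
    swap
    · simp at h
    obtain ⟨-, rfl, hs⟩ := h4
    rw [hs]
    obtain ⟨f', k1, k2, k3, ⟨-, -, ks⟩ | ⟨below, rest', y, hb, hy, hR, ks⟩⟩ :=
      exists_exitsAt pre' suf' (if pre ++ suf = [] then [] else (pre ++ suf) :: [])
    · rw [ks]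
    · exfalso
      split_ifs at hb with hw
      obtain ⟨rfl, rfl⟩ : pre ++ suf = below ∧ [] = rest' := by simpa using hb
      have a := hc f' k1
      have b := y.code_lt
      rw [lval, lval, rowVal_of_getElem? hy] at a
      simp only [RowRel, ColRel, lval] at *
      omega
  | cons below rest' ih =>
    intro r pre suf pre' suf' hcol hrow hT hc
    obtain ⟨hne, hbrow, hbab, hT'⟩ := hT
    simp only [List.headD_cons] at hcol
    obtain ⟨f, h1, h2, h3, ⟨hbf, hf, hs⟩ | ⟨below', rest'', y, he, hy, hR, hs⟩⟩ :=
      exists_exitsAt pre suf (below :: rest')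
    · simp only [List.headD_cons] at h3 hbf
      rw [hs]
      have hw : pre ++ suf ≠ [] := by
        intro hw
        rw [hw] at hf
        simp only [List.length_nil] at hf
        have := (lval_lt_iff (l := below) (c := f)).2 (by
          have : below.length ≠ 0 := by simpa using hne
          omega)
        omega
      rw [if_neg hw]
      obtain ⟨f', k1, k2, k3, ⟨-, -, ks⟩ | ⟨below', rest'', y, hb, hy, hR, ks⟩⟩ :=
        exists_exitsAt pre' suf' ((pre ++ suf) :: below :: rest')
      · rw [ks]
      · exfalso
        obtain ⟨rfl, -⟩ : pre ++ suf = below' ∧ _ = rest'' := by simpa using hb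
        have a := hc f' k1
        have b := y.code_lt
        rw [lval, lval, rowVal_of_getElem? hy] at a
        simp only [RowRel, ColRel, lval] at *
        omega
    · obtain ⟨rfl, rfl⟩ : below = below' ∧ rest' = rest'' := by simpa using he
      have hfb : f < below.length := by
        by_contra hc
        rw [List.getElem?_eq_none (by omega)] at hy
        simp at hy
      obtain ⟨e1, e2⟩ := lval_take_append_drop hfb.le
      have hpl : (below.take f).length = f := by simp [hfb.le]
      obtain ⟨n1, n2, n3⟩ := lval_take_cons_drop h2 y
      have hr' : IsRow Letter.code (2 * m) (2 * m + n) (Admissible m (r + 1))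
          (below.take f ++ below.drop (f + 1)) := hbrow.eraseCol f
      rw [hs]
      generalize (pre ++ suf).take f ++ y :: (pre ++ suf).drop f = ν at *
      simp only
      obtain ⟨f', k1, k2, k3, ⟨-, -, ks⟩ | ⟨below', rest'', y', hb, hy', hR', ks⟩⟩ :=
        exists_exitsAt pre' suf' (ν :: (slide (below.take f) (below.drop (f + 1)) rest').1)
      · rw [ks]
        exact Nat.zero_le _
      · obtain ⟨rfl, rfl⟩ : ν = below' ∧ _ = rest'' := by simpa using hb
        -- To the left of `f` the lower row is unchanged by the first slide. There the column
        -- relation forces the upper box to move right rather than down, so it cannot leave earlier.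
        have hff : f ≤ f' := by
          by_contra hlt
          have a := hc f' k1
          have b := y'.code_lt
          rw [← n1 f' (by omega), lval, lval, rowVal_of_getElem? hy'] at a
          simp only [RowRel, ColRel, lval] at *
          omega
        have hfν : f' < ν.length := by
          by_contra hc
          rw [List.getElem?_eq_none (by omega)] at hy'
          simp at hy'
        obtain ⟨d1, d2⟩ := lval_take_append_drop hfν.le
        have hpl' : (ν.take f').length = f' := by simp [hfν.le]
        rw [ks]
        have := ih (r + 1) (below.take f) (below.drop (f + 1)) (ν.take f') (ν.drop (f' + 1))
          (fun c hc => by rw [e2 c (by omega)]; exact hbab (c + 1)) hr' hT'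
          (fun c hc => by
            rw [d2 c (by omega), e2 c (by omega), n3 c (by omega)]
            exact hcol c (by omega))
        simpa using this

/-! ### A single insertion. -/

/-- The effect of an insertion on the first row. -/
theorem insertFrom_cons (r : ℕ) (x : Letter m n) (row : List (Letter m n))
    (rest : Filling (Letter m n)) :
    ((∀ c < row.length, RowRel (2 * m) (2 * m + n) (lval row c) x.code) ∧
        insertFrom r x (row :: rest) = ((row ++ [x]) :: rest, Change.added r)) ∨
      ∃ pre y suf, row = pre ++ y :: suf ∧
        (∀ c < pre.length, RowRel (2 * m) (2 * m + n) (lval row c) x.code) ∧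
        ColRel (2 * m) x.code y.code ∧
        ((y.code < 2 * m ∧ y.code < 2 * (r + 1) ∧ insertFrom r x (row :: rest) =
            ((slide pre suf rest).1, Change.removed (r + (slide pre suf rest).2))) ∨
          (Admissible m (r + 1) y.code ∧ insertFrom r x (row :: rest) =
            ((pre ++ x :: suf) :: (insertFrom (r + 1) y rest).1,
              (insertFrom (r + 1) y rest).2))) := by
  have hsplit := List.takeWhile_append_dropWhile (p := fun y => !x.bumps y) (l := row)
  have hpre : ∀ c < (row.takeWhile fun y => !x.bumps y).length,
      RowRel (2 * m) (2 * m + n) (lval row c) x.code := by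
    intro c hc
    obtain ⟨z, hz, -, e⟩ := exists_mem_rowVal (v := Letter.code) (N := 2 * m + n) hc
    have h1 := List.mem_takeWhile_imp hz
    rw [lval, ← hsplit, rowVal_append_left hc, e]
    have h2 : ¬ ColRel (2 * m) x.code z.code := by
      rw [← Letter.bumps_iff]
      simpa using h1
    simp only [RowRel, ColRel] at *
    omega
  rcases hd : row.dropWhile fun y => !x.bumps y with _ | ⟨y, suf⟩
  · left
    rw [hd, List.append_nil] at hsplit
    refine ⟨fun c hc => hpre c (by rwa [hsplit]), ?_⟩
    rw [insertFrom]
    simp only [hd]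
  · right
    refine ⟨_, y, suf, by rw [← hd, hsplit], hpre, ?_, ?_⟩
    · rw [← Letter.bumps_iff]
      have := List.head?_dropWhile_not (fun y => !x.bumps y) row
      rw [hd] at this
      simpa using this
    · have hv := Letter.violates_iff (r + 1) y
      by_cases h : y.violates (r + 1) = true
      · left
        refine ⟨(hv.1 h).1, (hv.1 h).2, ?_⟩
        rw [insertFrom]
        simp only [hd, h, if_true]
      · right
        refine ⟨fun h1 => ?_, ?_⟩
        · by_contra h2
          exact h (hv.2 ⟨h1, by omega⟩)
        · rw [insertFrom]
          simp only [hd, h]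
          rfl

/-- The last clause drives the induction: `g` is the row above, in which `z` has just displaced `x`
from column `p`. Since `x` can bump the entry below that column, it settles weakly to the left of
`p`, under entries of `g` that permit it. -/
theorem insertFrom_isTab (T : Filling (Letter m n)) : ∀ (r : ℕ) (x : Letter m n),
    IsLetterTab r T → Admissible m r x.code →
    IsLetterTab r (insertFrom r x T).1 ∧
      (∀ R, (insertFrom r x T).2 = Change.added R → r ≤ R ∧
        (insertFrom r x T).1.map List.length = addLen (R - r) (T.map List.length)) ∧
      (∀ R, (insertFrom r x T).2 = Change.removed R → r ≤ R ∧
        Removable (R - r) (T.map List.length) ∧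
        (insertFrom r x T).1.map List.length = removeLen (R - r) (T.map List.length)) ∧
      ∀ g (p : ℕ) (z : Letter m n), (∀ c < p, lval g c < x.code) → lval g p = z.code →
        ColRel (2 * m) z.code x.code →
        ColRel (2 * m) x.code (lval (T.headD []) p) →
        Above Letter.code (2 * m) (2 * m + n) g (T.headD []) →
        Above Letter.code (2 * m) (2 * m + n) g ((insertFrom r x T).1.headD []) := by
  induction T with
  | nil =>
    intro r x _ hx
    have hsing : ∀ c, lval [x] (c + 1) = 2 * m + n := fun c =>
      rowVal_of_length_le (by simp)
    have h0 : lval [x] 0 = x.code := rowVal_cons_zero _ _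
    have hxN := x.code_lt
    simp only [insertFrom]
    refine ⟨⟨by simp, ⟨by simpa using ⟨hxN, hx⟩, fun c => ?_⟩,
      above_nil (by omega) fun x _ => x.code_lt, trivial⟩, ?_, by simp, ?_⟩
    · cases c with
      | zero =>
        rw [← lval, ← lval, h0, hsing]
        exact Or.inl hxN
      | succ c =>
        rw [← lval, ← lval, hsing, hsing]
        exact Or.inr ⟨rfl, Or.inr rfl⟩
    · intro R hR
      obtain rfl : r = R := by simpa using hR
      simp [addLen]
    · intro g p z g1 g2 g3 g4 _ c
      have hle := lval_le g c
      simp only [List.headD_cons]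
      rw [← lval, ← lval]
      cases c with
      | zero =>
        rw [h0]
        rcases Nat.eq_zero_or_pos p with rfl | hp
        · rwa [g2]
        · exact Or.inl (g1 0 hp)
      | succ c =>
        rw [hsing]
        unfold ColRel
        omega
  | cons row rest ih =>
    intro r x hT hx
    obtain ⟨hne, hrow, hab, hT'⟩ := hT
    have hxN := x.code_lt
    rcases insertFrom_cons r x row rest with ⟨hall, hins⟩ | ⟨pre, y, suf, rfl, hpre, hxy, h⟩
    · rw [hins]
      have v1 : ∀ c < row.length, lval (row ++ [x]) c = lval row c := fun c hc =>
        rowVal_append_left hc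
      have v2 : lval (row ++ [x]) row.length = x.code := by
        rw [lval, rowVal_append_right le_rfl, Nat.sub_self, rowVal_cons_zero]
      have v3 : ∀ c, row.length < c → lval (row ++ [x]) c = 2 * m + n := fun c hc =>
        rowVal_of_length_le (by simpa using hc)
      have v4 : ∀ c, row.length ≤ c → lval row c = 2 * m + n := fun c hc =>
        rowVal_of_length_le hc
      refine ⟨⟨by simp, ⟨fun z hz => ⟨z.code_lt, ?_⟩, fun c => ?_⟩, fun c => ?_, hT'⟩, ?_, by simp,
        ?_⟩
      · rcases List.mem_append.1 hz with hz | hz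
        · exact (hrow.1 z hz).2
        · obtain rfl : z = x := by simpa using hz
          exact hx
      · rw [← lval, ← lval]
        rcases lt_trichotomy (c + 1) row.length with hc | hc | hc
        · rw [v1 c (by omega), v1 _ hc]
          exact hrow.2 c
        · rw [v1 c (by omega), hc, v2]
          exact hall c (by omega)
        · rw [v3 _ hc]
          have := lval_le (row ++ [x]) c
          unfold RowRel
          omega
      · rw [← lval, ← lval]
        have := hab c
        rcases lt_or_ge c row.length with hc | hc
        · rw [v1 c hc]
          exact this
        · rw [← lval, v4 c hc] at this
          have h1 := lval_le (row ++ [x]) c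
          simp only [ColRel, lval] at *
          omega
      · intro R hR
        obtain rfl : r = R := by simpa using hR
        simp [addLen]
      · intro g p z g1 g2 g3 g4 g5 c
        simp only [List.headD_cons] at *
        rw [← lval, ← lval]
        have a := g5 c
        have b := lval_le g c
        rcases lt_trichotomy c row.length with hc | rfl | hc
        · rw [v1 c hc]; exact a
        · rw [v2]
          rcases lt_trichotomy row.length p with hp | rfl | hp
          · exact Or.inl (g1 _ hp)
          · rwa [g2]
          -- Appending to the right of `p` would mean that `x` had passed over the entry in column
          -- `p`, which it can bump.
          · exfalso
            have := hall p hp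
            simp only [RowRel, ColRel, lval] at *
            omega
        · rw [v3 c hc]
          unfold ColRel
          omega
    · have w1 : ∀ c, c < pre.length → lval (pre ++ suf) c = lval (pre ++ y :: suf) c :=
        fun c hc => (rowVal_insert_lt hc).symm
      have w2 : ∀ c, pre.length ≤ c → lval (pre ++ suf) c = lval (pre ++ y :: suf) (c + 1) :=
        fun c hc => (rowVal_insert_gt hc).symm
      have w3 : lval (pre ++ y :: suf) pre.length = y.code := rowVal_insert_eq
      have hyN := y.code_lt
      rcases h with ⟨hy1, hy2, hins⟩ | ⟨hy, hins⟩
      · rw [hins]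
        have hc1 : ∀ c < pre.length,
            ColRel (2 * m) (lval (pre ++ suf) c) (lval (rest.headD []) c) := fun c hc => by
          rw [w1 c hc]; exact hab c
        have hc2 : ∀ c, pre.length ≤ c →
            ColRel (2 * m) (lval (pre ++ suf) c) (lval (rest.headD []) (c + 1)) := fun c hc => by
          rw [w2 c hc]; exact hab (c + 1)
        have hc3 : ∀ c < pre.length,
            lval (pre ++ suf) c < lval (rest.headD []) pre.length := fun c hc => by
          rw [w1 c hc]
          have a := hrow.val_lt hc
          have b := hab pre.length
          simp only [RowRel, ColRel, lval] at *
          omega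
        obtain ⟨s1, s2, s3, s4⟩ := slide_isTab rest r pre suf (hrow.erase) hc1 hc2 hc3 hT'
        have hl : (pre ++ suf).length + 1 = (pre ++ y :: suf).length := by
          simp only [List.length_append, List.length_cons]; omega
        rw [hl] at s2 s3
        refine ⟨s1, by simp, ?_, ?_⟩
        · intro R hR
          obtain rfl : r + (slide pre suf rest).2 = R := by simpa using hR
          rw [Nat.add_sub_cancel_left]
          exact ⟨by omega, s3, s2⟩
        · intro g p z g1 g2 g3 g4 g5
          simp only [List.headD_cons] at g4 g5
          have a1 := g5 pre.length
          have a2 := hab pre.length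
          have a3 := hrow.2 pre.length
          refine s4 g (fun c hc => ?_) (fun c hc => ?_) ?_ ?_
          · rw [w1 c hc]; exact g5 c
          · rw [w2 c hc]; exact g5 (c + 1)
          · rw [w2 _ le_rfl]
            by_cases hp : p = pre.length
            · subst hp
              simp only [RowRel, ColRel, lval] at *
              omega
            · have hp' : pre.length < p ∨ p < pre.length := by omega
              rcases hp' with hp' | hp'
              · have := g1 _ hp'
                simp only [RowRel, ColRel, lval] at *
                omega
              · have := hpre p hp'
                simp only [RowRel, ColRel, lval] at *
                omega
          · simp only [RowRel, ColRel, lval] at *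
            omega
      · rw [hins]
        have u1 : ∀ c, c ≠ pre.length → lval (pre ++ x :: suf) c = lval (pre ++ y :: suf) c :=
          fun c hc => rowVal_replace hc
        have u2 : lval (pre ++ x :: suf) pre.length = x.code := rowVal_insert_eq
        obtain ⟨i1, i2, i3, i4⟩ := ih (r + 1) y hT' hy
        refine ⟨⟨by simp, ⟨fun z hz => ⟨z.code_lt, ?_⟩, fun c => ?_⟩, ?_, i1⟩, ?_, ?_, ?_⟩
        · rw [List.mem_append, List.mem_cons] at hz
          rcases hz with hz | rfl | hz
          · exact (hrow.1 z (by simp [hz])).2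
          · exact hx
          · exact (hrow.1 z (by simp [hz])).2
        · rw [← lval, ← lval]
          have a := hrow.2 c
          by_cases h1 : c = pre.length
          · subst h1
            rw [u2, u1 _ (by omega)]
            simp only [RowRel, ColRel, lval] at *
            omega
          · rw [u1 c h1]
            by_cases h2 : c + 1 = pre.length
            · rw [h2, u2]
              exact hpre c (by omega)
            · rw [u1 _ h2]; exact a
        · refine i4 _ pre.length x (fun c hc => ?_) u2 hxy ?_ (fun c => ?_)
          · rw [u1 c (by omega)]
            have := hpre c hc
            simp only [RowRel, ColRel, lval] at *
            omega
          · have := hab pre.length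
            rwa [← lval, w3] at this
          · have := hab c
            rw [← lval, ← lval] at *
            by_cases h1 : c = pre.length
            · subst h1
              rw [u2]
              simp only [RowRel, ColRel, lval] at *
              omega
            · rwa [u1 c h1]
        · intro R hR
          obtain ⟨j1, j2⟩ := i2 R hR
          obtain ⟨d, rfl⟩ : ∃ d, R = r + 1 + d := ⟨R - (r + 1), by omega⟩
          rw [Nat.add_sub_cancel_left] at j2
          rw [show r + 1 + d - r = d + 1 by omega]
          refine ⟨by omega, ?_⟩
          simp [addLen, j2]
        · intro R hR
          obtain ⟨j1, j2, j3⟩ := i3 R hR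
          obtain ⟨d, rfl⟩ : ∃ d, R = r + 1 + d := ⟨R - (r + 1), by omega⟩
          rw [Nat.add_sub_cancel_left] at j2 j3
          rw [show r + 1 + d - r = d + 1 by omega]
          refine ⟨by omega, j2, ?_⟩
          simp [removeLen, j3]
        · intro g p z g1 g2 g3 g4 g5 c
          simp only [List.headD_cons] at *
          rw [← lval, ← lval]
          have a := g5 c
          by_cases h1 : c = pre.length
          · subst h1
            rw [u2]
            rcases lt_trichotomy pre.length p with hp | hp | hp
            · exact Or.inl (g1 _ hp)
            · rw [hp, g2]; exact g3
            · have := hpre p hp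
              simp only [RowRel, ColRel, lval] at *
              omega
          · rw [u1 c h1]; exact a

/-! ### Consecutive insertions under equal top entries. -/

/-- If the letter `y` bumped by `x` causes the removal of a box in row `R`, then an empty box moved
down afterwards from the row of `x` stops above row `R`. -/
theorem slide_lt_of_insertFrom_removed (rest : Filling (Letter m n)) :
    ∀ (r R : ℕ) (x y : Letter m n) (pre suf : List (Letter m n)),
    IsLetterTab r ((pre ++ y :: suf) :: rest) → Admissible m (r + 1) y.code →
    (∀ c < pre.length, RowRel (2 * m) (2 * m + n) (lval (pre ++ y :: suf) c) x.code) →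
    ColRel (2 * m) x.code y.code →
    (insertFrom (r + 1) y rest).2 = Change.removed R →
    ∀ (pre' suf' : List (Letter m n)) (z : Letter m n), pre ++ x :: suf = pre' ++ z :: suf' →
      r + (slide pre' suf' (insertFrom (r + 1) y rest).1).2 < R := by
  induction rest with
  | nil =>
    intro r R x y pre suf _ _ _ _ h
    simp [insertFrom] at h
  | cons row₁ rest₁ ih =>
    intro r R x y pre suf hT hy hpre hxy hrem pre' suf' z hz
    obtain ⟨-, hrow, hab, hT'⟩ := hT
    have w3 : lval (pre ++ y :: suf) pre.length = y.code := rowVal_insert_eq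
    have u1 : ∀ c, c ≠ pre.length → lval (pre ++ x :: suf) c = lval (pre ++ y :: suf) c :=
      fun c hc => rowVal_replace hc
    have u2 : lval (pre ++ x :: suf) pre.length = x.code := rowVal_insert_eq
    obtain ⟨hne₁, hrow₁, hab₁, hT₁⟩ := id hT'
    rcases insertFrom_cons (r + 1) y row₁ rest₁ with
      ⟨-, hins⟩ | ⟨pre₁, y₁, suf₁, rfl, hpre₁, hyy₁, ⟨hv1, hv2, hins⟩ | ⟨hy₁, hins⟩⟩
    · rw [hins] at hrem
      simp at hrem
    · rw [hins] at hrem ⊢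
      obtain rfl : r + 1 + (slide pre₁ suf₁ rest₁).2 = R := by simpa using hrem
      have key := slide_slide_le rest₁ (r + 1) pre₁ suf₁ pre' suf'
        (fun c hc => by
          have := hab₁ (c + 1)
          rwa [rowVal_insert_gt hc] at this) hrow₁.erase hT₁
        (fun c hc => by
          have e : lval (pre' ++ suf') c = lval (pre ++ x :: suf) (c + 1) := by
            rw [hz]; exact (rowVal_insert_gt hc).symm
          rw [e]
          have a := hab pre.length
          have hyN := y.code_lt
          simp only [List.headD_cons] at a hab
          -- Bumping moves weakly left: `y` can bump the entry below its former place.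
          have hpp : pre₁.length ≤ pre.length := by
            by_contra hlt
            have b := hpre₁ pre.length (by omega)
            simp only [RowRel, ColRel, lval] at *
            omega
          -- To the left of the lower gap the column relation is off by one column, and the
          -- symplectic condition replaces it. As `y` is admissible and bumps the violating `y₁`,
          -- their codes are exactly `2 * (r + 1)` and `2 * (r + 1) + 1`. Hence `x` and the entries
          -- before it have codes below `2 * (r + 1)`, while all entries of the lower row have at
          -- least this code.
          rcases lt_or_ge c pre₁.length with hc1 | hc1
          · have e1 : lval (pre₁ ++ suf₁) c = lval (pre₁ ++ y₁ :: suf₁) c :=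
              (rowVal_insert_lt hc1).symm
            have b := (hrow₁.of_mem (c := c) (by simp; omega)).2
            have d : lval (pre ++ x :: suf) (c + 1) ≤ x.code := by
              by_cases h1 : c + 1 = pre.length
              · rw [h1, u2]
              · rw [u1 _ h1]
                have := hpre (c + 1) (by omega)
                simp only [RowRel, lval] at *
                omega
            rw [e1]
            simp only [RowRel, ColRel, lval, Admissible] at *
            omega
          · have e1 : lval (pre₁ ++ suf₁) c = lval (pre₁ ++ y₁ :: suf₁) (c + 1) :=
              (rowVal_insert_gt hc1).symm
            rw [e1]
            have b := hab (c + 1)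
            by_cases h1 : c + 1 = pre.length
            · rw [h1, u2] at *
              simp only [RowRel, ColRel, lval] at *
              omega
            · rw [u1 _ h1]
              exact b)
      simp only
      omega
    · rw [hins] at hrem ⊢
      simp only at hrem ⊢
      have IH := ih (r + 1) R y y₁ pre₁ suf₁ hT' hy₁ hpre₁ hyy₁ hrem
      -- Only `r < R` is extracted here, for the case in which the empty box never leaves row `r`.
      have h0 := IH pre₁ suf₁ y rfl
      obtain ⟨f, h1, h2, h3, ⟨-, -, hs⟩ | ⟨below', rest'', t, he, ht, -, hs⟩⟩ :=
        exists_exitsAt pre' suf' ((pre₁ ++ y :: suf₁) :: (insertFrom (r + 1 + 1) y₁ rest₁).1)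
      · rw [hs]
        simp only
        omega
      · obtain ⟨rfl, rfl⟩ : pre₁ ++ y :: suf₁ = below' ∧ _ = rest'' := by simpa using he
        -- The box may enter the next row in any column, which is why the claim is made for every
        -- starting position.
        have := IH ((pre₁ ++ y :: suf₁).take f) ((pre₁ ++ y :: suf₁).drop (f + 1)) t (by
          obtain ⟨_, rfl⟩ := List.getElem?_eq_some_iff.1 ht
          simp)
        rw [hs]
        simp only
        omega

/-- Inserting `x'` after `x` has replaced `y` in a row. -/
theorem insertFrom_replaced (r : ℕ) {x x' y : Letter m n} {pre suf : List (Letter m n)}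
    (rest : Filling (Letter m n))
    (hpre : ∀ c < pre.length, RowRel (2 * m) (2 * m + n) (lval (pre ++ y :: suf) c) x.code)
    (hx : ColRel (2 * m) x'.code x.code) (hxy : ColRel (2 * m) x.code y.code) :
    ∃ pre' y' suf', pre ++ x :: suf = pre' ++ y' :: suf' ∧ ColRel (2 * m) y'.code y.code ∧
      ((insertFrom r x' ((pre ++ x :: suf) :: rest)).2 =
          Change.removed (r + (slide pre' suf' rest).2) ∨
        (Admissible m (r + 1) y'.code ∧ insertFrom r x' ((pre ++ x :: suf) :: rest) =
          ((pre' ++ x' :: suf') :: (insertFrom (r + 1) y' rest).1,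
            (insertFrom (r + 1) y' rest).2))) := by
  have u1 : ∀ c, c ≠ pre.length → lval (pre ++ x :: suf) c = lval (pre ++ y :: suf) c :=
    fun c hc => rowVal_replace hc
  have u2 : lval (pre ++ x :: suf) pre.length = x.code := rowVal_insert_eq
  have hxN := x.code_lt
  rcases insertFrom_cons r x' (pre ++ x :: suf) rest with
    ⟨hall, -⟩ | ⟨pre', y', suf', he, hpre', -, h⟩
  · exfalso
    have := hall pre.length (by simp)
    rw [u2] at this
    simp only [RowRel, ColRel] at *
    omega
  · refine ⟨pre', y', suf', he, ?_, ?_⟩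
    · have e : lval (pre ++ x :: suf) pre'.length = y'.code := by
        rw [he]; exact rowVal_insert_eq
      -- Since `x'` can bump `x`, the leftmost entry it bumps is `x` or lies to its left.
      rcases lt_trichotomy pre'.length pre.length with hp | hp | hp
      · have := hpre _ hp
        rw [← u1 _ (by omega), e] at this
        simp only [RowRel, ColRel] at *
        omega
      · rw [hp, u2] at e
        rwa [← e]
      · have := hpre' _ hp
        rw [u2] at this
        simp only [RowRel, ColRel] at *
        omega
    · rcases h with ⟨-, -, h⟩ | h
      · left; rw [h]
      · exact Or.inr h

/-- After a removal in row `R`, the insertion of a smaller letter causes a removal above row `R`. -/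
theorem insertFrom_removed_removed (T : Filling (Letter m n)) :
    ∀ (r R : ℕ) (x x' : Letter m n), IsLetterTab r T → Admissible m r x'.code →
    ColRel (2 * m) x'.code x.code → (insertFrom r x T).2 = Change.removed R →
    ∃ R' < R, (insertFrom r x' (insertFrom r x T).1).2 = Change.removed R' := by
  induction T with
  | nil =>
    intro r R x x' _ _ _ h
    simp [insertFrom] at h
  | cons row rest ih =>
    intro r R x x' hT hx' hxx hrem
    obtain ⟨-, hrow, hab, hT'⟩ := id hT
    rcases insertFrom_cons r x row rest with
      ⟨-, hins⟩ | ⟨pre, y, suf, rfl, hpre, hxy, ⟨hv1, hv2, hins⟩ | ⟨hy, hins⟩⟩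
    · rw [hins] at hrem
      simp at hrem
    -- A violation already in this row would require `x' < x < y` with the code of `x'` at least `2
    -- * r` and that of `y` at most `2 * r + 1`. So the second insertion never gets as far down as
    -- the row where the first met its violation.
    · exfalso
      have := (hrow.1 y (by simp)).2
      simp only [Admissible, ColRel] at *
      omega
    · rw [hins] at hrem ⊢
      simp only at hrem ⊢
      obtain ⟨pre', y', suf', he, hyy, h | ⟨hy', h⟩⟩ :=
        insertFrom_replaced r (insertFrom (r + 1) y rest).1 hpre hxx hxy
      · exact ⟨_, slide_lt_of_insertFrom_removed rest r R x y pre suf hT hy hpre hxy hrem _ _ _ he,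
          h⟩
      · rw [h]
        exact ih (r + 1) R y y' hT' hy' hyy hrem

/-- After a box has been added in row `R`, the insertion of a smaller letter does not add a box in
row `R` or above. -/
theorem insertFrom_added_added (T : Filling (Letter m n)) :
    ∀ (r R R' : ℕ) (x x' : Letter m n), IsLetterTab r T → Admissible m r x.code →
    ColRel (2 * m) x'.code x.code → (insertFrom r x T).2 = Change.added R →
    (insertFrom r x' (insertFrom r x T).1).2 = Change.added R' → R < R' := by
  -- Once `x` ends the row, `x'` has something to bump and cannot be appended there.
  have append : ∀ (row : List (Letter m n)) (rest : Filling (Letter m n)) (r R' : ℕ)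
      (x x' : Letter m n), IsLetterTab (r + 1) rest → ColRel (2 * m) x'.code x.code →
      (insertFrom r x' ((row ++ [x]) :: rest)).2 = Change.added R' → r < R' := by
    intro row rest r R' x x' hT hxx h
    rcases insertFrom_cons r x' (row ++ [x]) rest with
      ⟨hall, -⟩ | ⟨pre, y, suf, -, -, -, ⟨-, -, hins⟩ | ⟨hy, hins⟩⟩
    · exfalso
      have := hall row.length (by simp)
      rw [lval, rowVal_insert_eq] at this
      have := x.code_lt
      simp only [RowRel, ColRel] at *
      omega
    · rw [hins] at h
      simp at h
    · rw [hins] at h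
      exact ((insertFrom_isTab rest (r + 1) y hT hy).2.1 R' h).1
  induction T with
  | nil =>
    intro r R R' x x' _ _ hxx h h'
    simp only [insertFrom, Change.added.injEq] at h
    subst h
    exact append [] [] r R' x x' trivial hxx h'
  | cons row rest ih =>
    intro r R R' x x' hT hx hxx h h'
    obtain ⟨-, hrow, hab, hT'⟩ := id hT
    rcases insertFrom_cons r x row rest with
      ⟨-, hins⟩ | ⟨pre, y, suf, rfl, hpre, hxy, ⟨hv1, hv2, hins⟩ | ⟨hy, hins⟩⟩
    · rw [hins] at h h'
      simp only [Change.added.injEq] at h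
      subst h
      exact append row rest r R' x x' hT' hxx h'
    · rw [hins] at h
      simp at h
    · rw [hins] at h h'
      simp only at h h'
      obtain ⟨pre', y', suf', he, hyy, h1 | ⟨hy', h1⟩⟩ :=
        insertFrom_replaced r (insertFrom (r + 1) y rest).1 hpre hxx hxy
      · rw [h1] at h'
        simp at h'
      · rw [h1] at h'
        exact ih (r + 1) R R' y y' hT' hy hyy h h'

end Letters

/-! ### Recording tableaux: adding boxes and reverse dual insertion. -/

section Recording

variable {q : ℕ}

/-- The values of a row of numbers in `{1, …, q}`. -/
abbrev nval (q : ℕ) (l : List ℕ) (c : ℕ) : ℕ := rowVal id (q + 1) l c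

/-- Tableaux of numbers with strictly increasing rows and weakly increasing columns, all of whose
entries satisfy `E`. -/
abbrev IsDualTab (q : ℕ) (E : ℕ → Prop) (k : ℕ) (P : Filling ℕ) : Prop :=
  IsTab id 0 (q + 1) (fun _ => E) k P

/-- As `i` is maximal among the entries, the columns need only that the new shape is a partition.
Strictness of the row is the real requirement, hence the bound on the entries of row `r`. -/
theorem addBox_isTab {i : ℕ} {E : ℕ → Prop} (hi : E i) (hiq : i ≤ q) (hE : ∀ a, E a → a ≤ i)
    (P : Filling ℕ) : ∀ r k : ℕ, IsDualTab q E k P →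
    (addLen r (P.map List.length)).IsChain (· ≥ ·) →
    (∀ row, P[r]? = some row → ∀ x ∈ row, x < i) →
    IsDualTab q E k (addBox i r P) ∧
      (addBox i r P).map List.length = addLen r (P.map List.length) ∧
      ∀ g : List ℕ, (∀ x ∈ g, x ≤ i) → Above id 0 (q + 1) g (P.headD []) →
        (addLen r (P.map List.length)).headD 0 ≤ g.length →
        Above id 0 (q + 1) g ((addBox i r P).headD []) := by
  have append : ∀ (row below : List ℕ) (_ : IsRow id 0 (q + 1) E row) (_ : ∀ x ∈ row, x < i)
      (_ : Above id 0 (q + 1) row below), IsRow id 0 (q + 1) E (row ++ [i]) ∧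
      Above id 0 (q + 1) (row ++ [i]) below ∧
      ∀ g : List ℕ, (∀ x ∈ g, x ≤ i) → Above id 0 (q + 1) g row → row.length + 1 ≤ g.length →
        Above id 0 (q + 1) g (row ++ [i]) := by
    intro row below hrow hlt hab
    have v1 : ∀ c < row.length, nval q (row ++ [i]) c = nval q row c := fun c hc =>
      rowVal_append_left hc
    have v2 : nval q (row ++ [i]) row.length = i := rowVal_insert_eq
    have v3 : ∀ c, row.length < c → nval q (row ++ [i]) c = q + 1 := fun c hc =>
      rowVal_of_length_le (by simpa using hc)
    have v4 : ∀ c, row.length ≤ c → nval q row c = q + 1 := fun c hc =>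
      rowVal_of_length_le hc
    have hmem : ∀ x ∈ row ++ [i], id x < q + 1 ∧ E (id x) := by
      intro x hx
      rcases List.mem_append.1 hx with hx | hx
      · exact hrow.1 x hx
      · obtain rfl : x = i := by simpa using hx
        exact ⟨Nat.lt_succ_of_le hiq, hi⟩
    refine ⟨⟨hmem, fun c => ?_⟩, fun c => ?_, fun g g1 g2 g3 c => ?_⟩
    · rw [← nval, ← nval]
      rcases lt_trichotomy (c + 1) row.length with hc | hc | hc
      · rw [v1 c (by omega), v1 _ hc]
        exact hrow.2 c
      · rw [v1 c (by omega), hc, v2]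
        obtain ⟨x, hx, -, e⟩ := exists_mem_rowVal (v := id) (N := q + 1) (show c < row.length by omega)
        rw [nval, e]
        exact Or.inl (hlt x hx)
      · rw [v3 _ hc]
        have := rowVal_le (fun x hx => (hmem x hx).1) c
        simp only [nval, RowRel] at *
        omega
    · rw [← nval, ← nval]
      have := hab c
      rcases lt_or_ge c row.length with hc | hc
      · rw [v1 c hc]
        exact this
      · rw [← nval, v4 c hc] at this
        have h1 := rowVal_le (fun x hx => (hmem x hx).1) c
        simp only [ColRel, nval] at *
        omega
    · rw [← nval, ← nval]
      have a := g2 c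
      rcases lt_trichotomy c row.length with hc | rfl | hc
      · rw [v1 c hc]; exact a
      · rw [v2]
        obtain ⟨x, hx, -, e⟩ := exists_mem_rowVal (v := id) (N := q + 1)
          (show row.length < g.length by omega)
        rw [nval, e]
        have := g1 x hx
        simp only [ColRel, id]
        omega
      · rw [v3 c hc]
        rw [← nval, ← nval, v4 c hc.le] at a
        exact a
  induction P with
  | nil =>
    intro r k _ _ _
    cases r with
    | zero =>
      obtain ⟨h1, h2, h3⟩ := append [] [] IsRow.nil (by simp) (above_nil (by omega) (by simp))
      refine ⟨⟨by simp, h1, h2, trivial⟩, by simp [addBox, addLen], fun g g1 g2 g3 => ?_⟩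
      exact h3 g g1 g2 (by simpa [addLen] using g3)
    | succ r => exact ⟨trivial, rfl, fun g _ h _ => h⟩
  | cons row rest ih =>
    intro r k hT hch hlt
    obtain ⟨hne, hrow, hab, hT'⟩ := hT
    cases r with
    | zero =>
      obtain ⟨h1, h2, h3⟩ := append row _ hrow (hlt row (by simp)) hab
      refine ⟨⟨by simp, h1, h2, hT'⟩, by simp [addBox, addLen], fun g g1 g2 g3 => ?_⟩
      exact h3 g g1 g2 (by simpa [addLen] using g3)
    | succ r =>
      simp only [List.map_cons, addLen] at hch
      rw [List.isChain_cons] at hch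
      obtain ⟨i1, i2, i3⟩ := ih r (k + 1) hT' hch.2 (by simpa using hlt)
      refine ⟨⟨hne, hrow, i3 row (fun x hx => hE x (hrow.1 x hx).2) hab ?_, i1⟩, ?_,
        fun g _ h _ => h⟩
      · have := hch.1
        rcases h : addLen r (List.map List.length rest) with _ | ⟨a, l⟩
        · simp
        · rw [h] at this
          simpa using this
      · simp [addBox, addLen, i2]

/-- The column `p` certifies that some entry can be replaced. The replaced one, at `t`, is the last
such entry, so the path drifts weakly right on its way up. -/
theorem reverseBump_spec {E : ℕ → Prop} {row : List ℕ} (hrow : IsRow id 0 (q + 1) E row) {x p : ℕ}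
    (hx : x ≤ q) (hp : nval q row p ≤ x) :
    ∃ t, p ≤ t ∧ t < row.length ∧ nval q row t = (reverseBump x row).2 ∧
      (reverseBump x row).2 ≤ x ∧ (∀ c, t < c → x < nval q row c) ∧
      (∀ c, c ≠ t → nval q (reverseBump x row).1 c = nval q row c) ∧
      nval q (reverseBump x row).1 t = x ∧ (reverseBump x row).1.length = row.length ∧
      ∀ z ∈ (reverseBump x row).1, z ∈ row ∨ z = x := by
  unfold reverseBump
  have hsplit := List.takeWhile_append_dropWhile (p := fun y => decide (y ≤ x)) (l := row)
  have hmem : ∀ z ∈ row.takeWhile fun y => decide (y ≤ x), z ≤ x := fun z hz => by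
    simpa using List.mem_takeWhile_imp hz
  have hdrop : ∀ d ∈ (row.dropWhile fun y => decide (y ≤ x)).head?, x < d := by
    intro d hd
    have := List.head?_dropWhile_not (fun y => decide (y ≤ x)) row
    rw [hd] at this
    simpa using this
  generalize (row.takeWhile fun y => decide (y ≤ x)) = pre at *
  generalize (row.dropWhile fun y => decide (y ≤ x)) = suf at *
  have hsuf : ∀ c, pre.length ≤ c → x < nval q row c := by
    intro c hc
    refine lt_of_lt_of_le ?_ (hrow.val_le hc)
    rw [← hsplit, rowVal_append_right le_rfl, Nat.sub_self]
    cases suf with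
    | nil => rw [rowVal_nil]; omega
    | cons d l => rw [rowVal_cons_zero]; exact hdrop d rfl
  -- The initial segment is therefore nonempty, and the default `0` in `reverseBump` is never
  -- returned.
  have hpp : p < pre.length := by
    by_contra hc
    have := hsuf p (by omega)
    omega
  rcases List.eq_nil_or_concat' pre with rfl | ⟨front, e, rfl⟩
  · simp at hpp
  have hrow' : row = front ++ e :: suf := by simpa using hsplit.symm
  have e1 : (front ++ [e]).dropLast = front := by simp
  have e2 : (front ++ [e]).getLastD 0 = e := by simp
  simp only [e1, e2]
  simp only [List.length_append, List.length_singleton] at hpp hsuf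
  have hv : nval q row front.length = e := by rw [hrow']; exact rowVal_insert_eq
  refine ⟨front.length, by omega, by rw [hrow']; simp, hv, hmem e (by simp),
    fun c hc => hsuf c (by omega), fun c hc => ?_, rowVal_insert_eq, by rw [hrow']; simp, ?_⟩
  · rw [hrow']; exact rowVal_replace hc
  · intro z hz
    rw [hrow']
    simp only [List.mem_append, List.mem_cons] at hz ⊢
    tauto

/-- The row above only has to know that the first row changes in a single column `p`, where its
value does not decrease. The old value there is the entry sent up, which bounds the entry above it
and so supplies the certificate for `reverseBump_spec`. -/
theorem reverseDualInsert_spec {E : ℕ → Prop} (P : Filling ℕ) : ∀ r k : ℕ, IsDualTab q E k P →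
    Removable r (P.map List.length) →
    IsDualTab q E k (reverseDualInsert r P).1 ∧
      (reverseDualInsert r P).1.map List.length = removeLen r (P.map List.length) ∧
      E (reverseDualInsert r P).2 ∧ (reverseDualInsert r P).2 ≤ q ∧
      ∃ p, nval q (P.headD []) p = (reverseDualInsert r P).2 ∧
        (∀ c, c ≠ p →
          nval q ((reverseDualInsert r P).1.headD []) c = nval q (P.headD []) c) ∧
        (reverseDualInsert r P).2 ≤ nval q ((reverseDualInsert r P).1.headD []) p := by
  induction P with
  | nil =>
    intro r k _ h
    cases r <;> exact h.elim
  | cons row rest ih =>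
    intro r k hT hrem
    obtain ⟨hne, hrow, hab, hT'⟩ := hT
    cases r with
    | zero =>
      rcases List.eq_nil_or_concat' row with rfl | ⟨front, e, rfl⟩
      · exact absurd rfl hne
      have e1 : (front ++ [e]).dropLast = front := by simp
      have e2 : (front ++ [e]).getLastD 0 = e := by simp
      simp only [reverseDualInsert, e1, e2]
      have he := hrow.1 e (by simp)
      simp only [Removable, List.map_cons] at hrem
      have hv : nval q (front ++ [e]) front.length = e := rowVal_insert_eq
      have hc1 : ∀ c, c ≠ front.length → nval q front c = nval q (front ++ [e]) c := by
        intro c hc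
        rcases Nat.lt_or_gt_of_ne hc with hc | hc
        · exact (rowVal_append_left hc).symm
        · rw [nval, nval, rowVal_of_length_le hc.le, rowVal_of_length_le (by simpa using hc)]
      have hN : nval q front front.length = q + 1 := rowVal_of_length_le le_rfl
      have hirow : IsRow id 0 (q + 1) E front := by
        have := hrow.erase (suf := [])
        simpa using this
      have heq : e ≤ q := Nat.lt_succ_iff.1 he.1
      split_ifs with h0
      · subst h0
        -- A corner in a row of length one leaves no room for a nonempty row below.
        have hr : rest = [] := by
          cases rest with
          | nil => rfl
          | cons b l =>
            exact absurd (by simpa using hrem) hT'.1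
        subst hr
        refine ⟨trivial, by simp [removeLen], he.2, heq, 0, hv, ?_, ?_⟩
        · intro c hc
          exact hc1 c hc
        · simp only [List.headD_nil, nval, rowVal_nil]
          omega
      · have h0' : front.length ≠ 0 := by simpa using h0
        refine ⟨⟨h0, hirow, fun c => ?_, hT'⟩, ?_, he.2, heq, front.length, hv, hc1, ?_⟩
        · by_cases hc : c < front.length
          · have := hab c
            rwa [← nval, ← hc1 c (by omega)] at this
          · have h1 := rowVal_le (fun x hx => (hirow.1 x hx).1) c
            have h2 : nval q (rest.headD []) c = q + 1 := by
              refine rowVal_of_length_le ?_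
              cases rest with
              | nil => simp
              | cons b l =>
                simp at hrem ⊢
                omega
            rw [← nval, ← nval, h2]
            simp only [ColRel, nval] at *
            omega
        · simp only [List.map_cons, removeLen, List.length_append, List.length_singleton]
          rw [if_neg (by omega), Nat.add_sub_cancel]
        · simp only [List.headD_cons, hN]
          omega
    | succ r =>
      obtain ⟨i1, i2, i3, i4, p, i5, i6, i7⟩ := ih r (k + 1) hT' hrem
      simp only [reverseDualInsert]
      have hp := hab p
      have hp' : nval q row p ≤ (reverseDualInsert r rest).2 := by
        rw [← i5]
        simp only [ColRel, nval] at *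
        omega
      obtain ⟨t, t1, t2, t3, t4, t5, t6, t7, t8, t9⟩ := reverseBump_spec hrow i4 hp'
      generalize reverseDualInsert r rest = res at *
      generalize reverseBump res.2 row = b at *
      have hb : IsRow id 0 (q + 1) E b.1 := by
        refine ⟨fun z hz => ?_, fun c => ?_⟩
        · rcases t9 z hz with h | rfl
          · exact hrow.1 z h
          · exact ⟨Nat.lt_succ_of_le i4, i3⟩
        · have a := hrow.2 c
          rw [← nval, ← nval]
          by_cases h1 : c = t
          · subst h1
            rw [t7, t6 _ (by omega)]
            exact Or.inl (t5 _ (by omega))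
          · rw [t6 c h1]
            by_cases h2 : c + 1 = t
            · subst h2
              rw [t7]
              simp only [RowRel, nval] at *
              omega
            · rw [t6 _ h2]
              exact a
      have hrt := hrow.of_mem t2
      refine ⟨⟨?_, hb, fun c => ?_, i1⟩, by simp [removeLen, t8, i2], ?_, by omega, t, ?_, ?_, ?_⟩
      · intro h
        rw [h] at t8
        exact hne (List.length_eq_zero_iff.1 t8.symm)
      · rw [← nval, ← nval]
        have hrr := hT'.isRow_headD
        have a := hab c
        -- Only columns `t` and `p` change. The entry placed at `t ≥ p` used to stand in column `p`
        -- one row below, so it is at most everything now below column `t`.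
        by_cases h1 : c = t
        · subst h1
          rw [t7]
          by_cases h2 : c = p
          · subst h2
            simp only [ColRel, nval] at *
            omega
          · rw [i6 c h2, ← i5]
            have := hrr.val_le t1
            simp only [ColRel, nval] at *
            omega
        · rw [t6 c h1]
          by_cases h2 : c = p
          · subst h2
            simp only [ColRel, nval] at *
            omega
          · rw [i6 c h2]
            exact a
      · rw [← t3]; exact hrt.2
      · exact t3
      · exact t6
      · simp only [List.headD_cons, t7]
        exact t4

theorem nval_le_getLastD {E : ℕ → Prop} {row : List ℕ} (hrow : IsRow id 0 (q + 1) E row) {t : ℕ}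
    (ht : t < row.length) : nval q row t ≤ row.getLastD 0 := by
  rcases List.eq_nil_or_concat' row with rfl | ⟨front, e, rfl⟩
  · simp at ht
  · have := hrow.val_le (show t ≤ front.length by simp at ht; omega)
    rw [rowVal_insert_eq] at this
    simpa using this

/-- If a second box is removed above the first one, then the entry bumped out of the first row is
not smaller. -/
theorem reverseDualInsert_le {E : ℕ → Prop} (P : Filling ℕ) : ∀ r r' k : ℕ, r' < r →
    IsDualTab q E k P → Removable r (P.map List.length) →
    Removable r' ((reverseDualInsert r P).1.map List.length) →
    (reverseDualInsert r P).2 ≤ (reverseDualInsert r' (reverseDualInsert r P).1).2 := by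
  induction P with
  | nil =>
    intro r r' k _ _ h
    cases r <;> exact h.elim
  | cons row rest ih =>
    intro r r' k hr hT hrem hrem'
    have hT1 := (reverseDualInsert_spec (row :: rest) r k hT hrem).1
    obtain ⟨hne, hrow, hab, hT'⟩ := hT
    cases r with
    | zero => omega
    | succ r =>
      obtain ⟨i1, i2, i3, i4, p, i5, i6, i7⟩ := reverseDualInsert_spec rest r (k + 1) hT' hrem
      have hp := hab p
      have hp' : nval q row p ≤ (reverseDualInsert r rest).2 := by
        rw [← i5]
        simp only [ColRel, nval] at *
        omega
      obtain ⟨t, t1, t2, t3, t4, t5, t6, t7, t8, t9⟩ := reverseBump_spec hrow i4 hp'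
      cases r' with
      | zero =>
        -- The second path starts at the end of this row, weakly right of the box `t` into which the
        -- first path put its entry.
        simp only [reverseDualInsert]
        have := nval_le_getLastD hT1.2.1 (t := t) (by rw [t8]; exact t2)
        rw [t7] at this
        omega
      | succ r' =>
        have IH := ih r r' (k + 1) (by omega) hT' hrem hrem'
        obtain ⟨-, -, -, j4, -⟩ := reverseDualInsert_spec _ r' (k + 1) i1 hrem'
        simp only [reverseDualInsert]
        -- By induction the second entry coming up is at least the first, which now stands at `t`;
        -- hence the second path passes through `t' ≥ t` and bumps out at least that value.
        obtain ⟨t', s1, s2, s3, s4, -⟩ := reverseBump_spec hT1.2.1 j4 (p := t) (by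
          rw [t7]; exact IH)
        have := hT1.2.1.val_le s1
        rw [← nval, ← nval, s3, t7] at this
        omega

end Recording

/-! ### Young diagrams, entries and transposes. -/

section Shape

variable {α : Type} {v : α → ℕ} {M N : ℕ} {E : ℕ → ℕ → Prop}

theorem IsTab.isRow_getD (hM : M ≤ N) (T : Filling α) : ∀ k r : ℕ, IsTab v M N E k T →
    IsRow v M N (E (k + r)) (T.getD r []) ∧ Above v M N (T.getD r []) (T.getD (r + 1) []) := by
  induction T with
  | nil =>
    intro k r _
    exact ⟨IsRow.nil, above_nil hM (by simp)⟩
  | cons row rest ih =>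
    intro k r hT
    obtain ⟨-, hrow, hab, hT'⟩ := hT
    cases r with
    | zero =>
      refine ⟨hrow, ?_⟩
      cases rest <;> exact hab
    | succ r =>
      have := ih (k + 1) r hT'
      rw [show k + 1 + r = k + (r + 1) by omega] at this
      exact this

theorem IsTab.val_col (hM : M ≤ N) {T : Filling α} (hT : IsTab v M N E 0 T) {r r' : ℕ}
    (hr : r < r') (c : ℕ) : ColRel M (rowVal v N (T.getD r []) c) (rowVal v N (T.getD r' []) c) := by
  induction r', hr using Nat.le_induction with
  | base => exact (hT.isRow_getD hM T 0 r).2 c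
  | succ k _ ih =>
    have := (hT.isRow_getD hM T 0 k).2 c
    simp only [ColRel] at *
    omega

theorem IsTab.val_le (hM : M ≤ N) {T : Filling α} (hT : IsTab v M N E 0 T) {r r' c c' : ℕ}
    (hr : r ≤ r') (hc : c ≤ c') :
    rowVal v N (T.getD r []) c ≤ rowVal v N (T.getD r' []) c' := by
  have h1 := (hT.isRow_getD hM T 0 r).1.val_le hc
  rcases hr.eq_or_lt with rfl | hr
  · exact h1
  · have := hT.val_col hM hr c'
    simp only [ColRel] at this
    omega

theorem IsTab.lengths (T : Filling α) : ∀ k : ℕ, IsTab v M N E k T →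
    (T.map List.length).IsChain (· ≥ ·) ∧ ∀ a ∈ T.map List.length, 0 < a := by
  induction T with
  | nil => intro k _; simp
  | cons row rest ih =>
    intro k hT
    obtain ⟨hne, hrow, hab, hT'⟩ := hT
    obtain ⟨h1, h2⟩ := ih _ hT'
    refine ⟨?_, ?_⟩
    · rw [List.map_cons, List.isChain_cons]
      refine ⟨fun a ha => ?_, h1⟩
      cases rest with
      | nil => simp at ha
      | cons b l =>
        obtain rfl : b.length = a := by simpa using ha
        exact hab.length_le hT'.2.1.lt
    · intro a ha
      rw [List.map_cons, List.mem_cons] at ha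
      rcases ha with rfl | ha
      · exact List.length_pos_iff.2 hne
      · exact h2 a ha

theorem Filling.entry_eq (T : Filling α) (r c : ℕ) : T.entry r c = (T.getD r [])[c]? := by
  unfold Filling.entry
  rw [List.getD_eq_getElem?_getD]
  cases T[r]? <;> simp

theorem Filling.HasShape.mem_iff {T : Filling α} {lam : YoungDiagram} (h : T.HasShape lam)
    {r c : ℕ} : (r, c) ∈ lam ↔ c < (T.getD r []).length := by
  have hlen : T.length = lam.colLen 0 := by
    rw [← YoungDiagram.length_rowLens, ← h, List.length_map]
  rcases lt_or_ge r T.length with hr | hr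
  · rw [YoungDiagram.mem_iff_lt_rowLen]
    have h1 : lam.rowLens[r]? = some (lam.rowLen r) := by
      rw [YoungDiagram.rowLens, List.getElem?_map, List.getElem?_range (by omega)]
      rfl
    rw [← show T.map List.length = lam.rowLens from h] at h1
    simp [hr] at h1
    simp [List.getD_eq_getElem?_getD, hr, h1]
  · have h0 : T.getD r [] = [] := by simp [List.getD_eq_getElem?_getD, hr]
    rw [h0]
    simp only [List.length_nil, not_lt_zero, iff_false]
    intro hm
    have := lam.up_left_mem le_rfl (Nat.zero_le c) hm
    rw [YoungDiagram.mem_iff_lt_colLen] at this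
    omega

theorem IsTab.exists_hasShape {T : Filling α} (hT : IsTab v M N E 0 T) :
    ∃ lam : YoungDiagram, T.HasShape lam := by
  obtain ⟨h1, h2⟩ := hT.lengths T 0
  exact ⟨YoungDiagram.ofRowLens _ h1.sortedGE, (YoungDiagram.rowLens_ofRowLens_eq_self h2).symm⟩

/-- With weakly decreasing row lengths the missing boxes of a column are all at the bottom, so
`filterMap` shifts no entry. -/
theorem getElem?_filterMap_col (c : ℕ) (T : Filling α) :
    ∀ r : ℕ, (T.map List.length).IsChain (· ≥ ·) →
      (T.filterMap fun row => row[c]?)[r]? = (T.getD r [])[c]? := by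
  induction T with
  | nil => intro r _; simp
  | cons row rest ih =>
    intro r h
    have hp := h.pairwise
    rw [List.map_cons] at h hp
    rcases hc : row[c]? with _ | x
    · have hlen : row.length ≤ c := List.getElem?_eq_none_iff.1 hc
      have hall : ∀ l ∈ row :: rest, l[c]? = none := by
        intro l hl
        rw [List.mem_cons] at hl
        rcases hl with rfl | hl
        · exact hc
        · have := (List.pairwise_cons.1 hp).1 _ (List.mem_map_of_mem (f := List.length) hl)
          exact List.getElem?_eq_none (this.le.trans hlen)
      have h0 : (row :: rest).filterMap (fun row => row[c]?) = [] :=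
        List.filterMap_eq_nil_iff.2 hall
      rw [h0]
      rcases lt_or_ge r (row :: rest).length with hr | hr
      · rw [List.getD_eq_getElem _ _ hr, hall _ (List.getElem_mem hr)]
        simp
      · rw [List.getD_eq_default _ _ hr]
        simp
    · rw [List.filterMap_cons_some (f := fun row : List α => row[c]?) hc]
      cases r with
      | zero => simp [hc]
      | succ r => simpa using ih r h.tail

end Shape

/-! ### From value functions back to the tableaux of the theorem. -/

/-- A tableau of letters is an `spo`-tableau. -/
theorem IsLetterTab.isSpoTableau {m n : ℕ} {T : Filling (Letter m n)} (hT : IsLetterTab 0 T)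
    {lam : YoungDiagram} (hs : T.HasShape lam) : IsSpoTableau lam T := by
  have hM : 2 * m ≤ 2 * m + n := by omega
  have hval : ∀ {r c x}, T.entry r c = some x → lval (T.getD r []) c = x.code := by
    intro r c x h
    rw [Filling.entry_eq] at h
    exact rowVal_of_getElem? h
  have hmem : ∀ {r c x}, T.entry r c = some x → (r, c) ∈ lam := by
    intro r c x h
    rw [Filling.entry_eq] at h
    exact hs.mem_iff.2 (List.getElem?_eq_some_iff.1 h).1
  have hE : ∀ r c, (r, c) ∈ lam → Admissible m r (lval (T.getD r []) c) := by
    intro r c h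
    have := ((hT.isRow_getD hM T 0 r).1.of_mem (hs.mem_iff.1 h)).2
    rwa [Nat.zero_add] at this
  -- Codes increase weakly along rows and columns, so the boxes with code below `2 * m` form a
  -- diagram.
  let mu : YoungDiagram :=
    { cells := lam.cells.filter fun p => lval (T.getD p.1 []) p.2 < 2 * m
      isLowerSet := by
        rintro ⟨r', c'⟩ ⟨r, c⟩ ⟨hr, hc⟩ h
        simp only [Finset.coe_filter, YoungDiagram.mem_cells, Set.mem_ofPred_eq] at h ⊢
        exact ⟨lam.up_left_mem hr hc h.1, lt_of_le_of_lt (hT.val_le hM hr hc) h.2⟩ }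
  have hmu : ∀ r c, (r, c) ∈ mu ↔ (r, c) ∈ lam ∧ lval (T.getD r []) c < 2 * m := by
    intro r c
    rw [← YoungDiagram.mem_cells]
    simp [mu]
  refine ⟨hs, mu, ?_, ?_, ?_, ?_, ?_, ?_, ?_, ?_⟩
  · rw [← YoungDiagram.cells_subset_iff]
    exact Finset.filter_subset _ _
  -- A box of `mu` in row `m` would be admissible only with code at least `2 * m`.
  · by_contra h
    have h1 : (m, 0) ∈ mu := YoungDiagram.mem_iff_lt_colLen.2 (by omega)
    obtain ⟨h2, h3⟩ := (hmu _ _).1 h1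
    have := hE m 0 h2 h3
    omega
  · intro r c x h
    rw [hmu, hval h, Letter.inB0_iff]
    exact and_iff_right (hmem h)
  · intro r c c' x y hc hx hy _ _
    have := (hT.isRow_getD hM T 0 r).1.val_le hc.le
    rwa [← lval, ← lval, hval hx, hval hy] at this
  · intro r r' c x y hr hx hy bx _
    have := hT.val_col hM hr c
    rw [← lval, ← lval, hval hx, hval hy] at this
    rw [Letter.inB0_iff] at bx
    rw [Letter.lt_iff_code]
    simp only [ColRel] at this
    omega
  · intro r c x hx _
    rw [← Bool.not_eq_true, Letter.violates_iff]
    have := hE r c (hmem hx)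
    rw [hval hx] at this
    simp only [Admissible] at this
    omega
  · intro r c c' x y hc hx hy bx _
    have := (hT.isRow_getD hM T 0 r).1.val_lt hc
    rw [← lval, ← lval, hval hx, hval hy] at this
    rw [Letter.inB0_eq_false_iff] at bx
    have := x.code_lt
    rw [Letter.lt_iff_code]
    simp only [RowRel] at *
    omega
  · intro r r' c x y hr hx hy _ _
    have := hT.val_le hM hr.le (le_refl c)
    rwa [← lval, ← lval, hval hx, hval hy] at this

/-- The transpose of a dual tableau is semistandard. -/
theorem IsDualTab.isSemistandard_transpose {q : ℕ} {P : Filling ℕ}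
    (hP : IsDualTab q (fun a => 1 ≤ a ∧ a ≤ q) 0 P) {lam : YoungDiagram} (hs : P.HasShape lam) :
    IsSemistandard q lam.transpose P.transpose := by
  have hM : 0 ≤ q + 1 := by omega
  have hch := (hP.lengths P 0).1
  have hcol := fun c r => getElem?_filterMap_col c P r hch
  have hmemT : ∀ {r c}, (r, c) ∈ lam.transpose ↔ r < (P.getD c []).length := by
    intro r c
    rw [YoungDiagram.mem_transpose, Prod.swap_prod_mk, hs.mem_iff]
  have hhead : (P.headD []).length = lam.rowLen 0 := by
    have h1 : P.headD [] = P.getD 0 [] := by cases P <;> rfl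
    refine eq_of_forall_lt_iff fun c => ?_
    rw [h1, ← hs.mem_iff, YoungDiagram.mem_iff_lt_rowLen]
  have hlt : ∀ {r c}, r < (P.getD c []).length → nval q (P.getD c []) r < q + 1 ∧
      1 ≤ nval q (P.getD c []) r ∧ nval q (P.getD c []) r ≤ q := fun {r c} h =>
    (hP.isRow_getD hM P 0 c).1.of_mem h
  -- `SemistandardYoungTableau` demands zeros outside the shape, whereas `nval` gives `q + 1` there.
  refine ⟨?_, ⟨fun i j => if (i, j) ∈ lam.transpose then nval q (P.getD j []) i else 0,
    ?_, ?_, ?_⟩, ?_⟩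
  · unfold Filling.HasShape Filling.transpose
    rw [YoungDiagram.rowLens, YoungDiagram.colLen_transpose, hhead, List.map_map]
    refine List.map_congr_left fun c _ => ?_
    rw [YoungDiagram.rowLen_transpose]
    refine eq_of_forall_lt_iff fun r => ?_
    rw [← YoungDiagram.mem_iff_lt_colLen, hs.mem_iff, Function.comp_apply, ← not_iff_not,
      not_lt, not_lt, ← List.getElem?_eq_none_iff, hcol, List.getElem?_eq_none_iff]
  · intro i j1 j2 hj h
    rw [if_pos h, if_pos (lam.transpose.up_left_mem le_rfl hj.le h)]
    exact hP.val_le hM hj.le le_rfl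
  · intro i1 i2 j hi h
    rw [if_pos h, if_pos (lam.transpose.up_left_mem hi.le le_rfl h)]
    have h1 := (hP.isRow_getD hM P 0 j).1.val_lt hi
    have h2 := hlt (hmemT.1 h)
    simp only [RowRel, nval] at *
    omega
  · intro i j h
    rw [if_neg h]
  · intro r c h
    have h1 := hmemT.1 h
    have hr : r < (P.headD []).length := by
      rw [hhead, ← YoungDiagram.mem_iff_lt_rowLen]
      exact lam.up_left_mem (Nat.zero_le c) le_rfl (YoungDiagram.mem_transpose.1 h)
    have hS : (if (r, c) ∈ lam.transpose then nval q (P.getD c []) r else 0) =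
        nval q (P.getD c []) r := if_pos h
    refine ⟨?_, ?_⟩
    · have e : P.transpose[r]? = some (P.filterMap fun row => row[r]?) := by
        unfold Filling.transpose
        rw [List.getElem?_map, List.getElem?_range hr]
        rfl
      unfold Filling.entry
      rw [e, Option.bind_some, hcol, List.getElem?_eq_getElem h1]
      refine congrArg some (Eq.trans ?_ hS.symm)
      rw [nval, rowVal, List.getElem?_eq_getElem h1]
      rfl
    · have := (hlt h1).2
      rw [← hS] at this
      exact this

/-! ### Invariants of the whole correspondence. -/

variable {m n q : ℕ}

theorem addBox_getElem? {i : ℕ} {row : List ℕ} (P : Filling ℕ) : ∀ R r : ℕ, R < r →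
    (addBox i R P)[r]? = some row → P[r]? = some row := by
  induction P with
  | nil =>
    intro R r hr h
    cases R with
    | zero =>
      cases r with
      | zero => omega
      | succ r => simp [addBox] at h
    | succ R => exact h
  | cons a l ih =>
    intro R r hr h
    cases r with
    | zero => omega
    | succ r =>
      cases R with
      | zero => exact h
      | succ R => exact ih R r (by omega) h

theorem IsTab.of_mem {α : Type} {v : α → ℕ} {M N : ℕ} {E : ℕ → Prop} (T : Filling α) :
    ∀ k : ℕ, IsTab v M N (fun _ => E) k T → ∀ row ∈ T, ∀ x ∈ row, E (v x) := by
  induction T with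
  | nil => intro k _ row h; simp at h
  | cons a l ih =>
    intro k hT row h x hx
    rw [List.mem_cons] at h
    rcases h with rfl | h
    · exact (hT.2.1.1 x hx).2
    · exact ih _ hT.2.2.2 row h x hx

theorem IsTab.imp {α : Type} {v : α → ℕ} {M N : ℕ} {E E' : ℕ → Prop} (hE : ∀ a, E a → E' a)
    (T : Filling α) :
    ∀ k : ℕ, IsTab v M N (fun _ => E) k T → IsTab v M N (fun _ => E') k T := by
  induction T with
  | nil => intro k _; trivial
  | cons a l ih =>
    intro k hT
    exact ⟨hT.1, ⟨fun x hx => ⟨(hT.2.1.1 x hx).1, hE _ (hT.2.1.1 x hx).2⟩, hT.2.1.2⟩, hT.2.2.1,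
      ih _ hT.2.2.2⟩

/-- The invariants of the correspondence after columns with top entries at most `i`. -/
structure Good (q i : ℕ) (s : State m n) : Prop where
  tab : IsLetterTab 0 s.spo
  recTab : IsDualTab q (fun a => 1 ≤ a ∧ a ≤ i) 0 s.recording
  shape : s.recording.map List.length = s.spo.map List.length
  chain : s.arr.IsChain fun p p' => p.1 ≤ p'.1 ∧ (p.1 = p'.1 → p.2 ≤ p'.2)
  arr_mem : ∀ p ∈ s.arr, 1 ≤ p.2 ∧ p.2 ≤ p.1 ∧ p.1 ≤ i

theorem Good.mono {i i' : ℕ} {s : State m n} (h : Good q i s) (hi : i ≤ i') : Good q i' s where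
  tab := h.tab
  recTab := h.recTab.imp (fun _ ha => ⟨ha.1, ha.2.trans hi⟩) _ 0
  shape := h.shape
  chain := h.chain
  arr_mem p hp := ⟨(h.arr_mem p hp).1, (h.arr_mem p hp).2.1, (h.arr_mem p hp).2.2.trans hi⟩

/-- The column `col` may be processed next. -/
structure Ready (q : ℕ) (s : State m n) (col : ℕ × Letter m n) : Prop where
  good : Good q col.1 s
  added : ∀ R, (spoInsert s.spo col.2).2 = Change.added R → (∀ p ∈ s.arr, p.1 < col.1) ∧
    ∀ r, R ≤ r → ∀ row, s.recording[r]? = some row → ∀ x ∈ row, x < col.1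
  removed : ∀ R, (spoInsert s.spo col.2).2 = Change.removed R →
    ∀ p ∈ s.arr.getLast?, p.1 = col.1 → p.2 ≤ (reverseDualInsert R s.recording).2

theorem step_of_added {s : State m n} {col : ℕ × Letter m n} {R : ℕ}
    (h : (spoInsert s.spo col.2).2 = Change.added R) :
    step s col = ⟨(spoInsert s.spo col.2).1, addBox col.1 R s.recording, s.arr⟩ := by
  simp [step, h]

theorem step_of_removed {s : State m n} {col : ℕ × Letter m n} {R : ℕ}
    (h : (spoInsert s.spo col.2).2 = Change.removed R) :
    step s col = ⟨(spoInsert s.spo col.2).1, (reverseDualInsert R s.recording).1,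
      s.arr ++ [(col.1, (reverseDualInsert R s.recording).2)]⟩ := by
  simp [step, h]

theorem admissible_zero (a : ℕ) : Admissible m 0 a := fun _ => Nat.zero_le _

theorem Good.removable {i R : ℕ} {s : State m n} (h : Good q i s) {b : Letter m n}
    (hR : (spoInsert s.spo b).2 = Change.removed R) :
    Removable R (s.recording.map List.length) := by
  rw [h.shape]
  exact ((insertFrom_isTab s.spo 0 b h.tab (admissible_zero _)).2.2.1 R hR).2.1

/-- The recording tableau borrows from the letter tableau that the new shape is a partition. The
Burge inequality holds because every recorded entry is at most the current top entry. -/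
theorem Ready.good_step {s : State m n} {col : ℕ × Letter m n} (h : Ready q s col)
    (h1 : 1 ≤ col.1) (hq : col.1 ≤ q) : Good q col.1 (step s col) := by
  obtain ⟨i1, i2, i3, -⟩ := insertFrom_isTab s.spo 0 col.2 h.good.tab (admissible_zero _)
  rcases hch : (spoInsert s.spo col.2).2 with R | R
  · rw [step_of_added hch]
    obtain ⟨-, j2⟩ := i2 R hch
    rw [Nat.sub_zero, ← h.good.shape] at j2
    obtain ⟨k1, k2, -⟩ := addBox_isTab (q := q) (E := fun a => 1 ≤ a ∧ a ≤ col.1) ⟨h1, le_rfl⟩ hq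
      (fun a ha => ha.2) s.recording R 0 h.good.recTab (j2 ▸ (i1.lengths _ 0).1)
      ((h.added R hch).2 R le_rfl)
    exact ⟨i1, k1, k2.trans j2.symm, h.good.chain, h.good.arr_mem⟩
  · rw [step_of_removed hch]
    obtain ⟨-, -, j2⟩ := i3 R hch
    rw [Nat.sub_zero, ← h.good.shape] at j2
    obtain ⟨k1, k2, k3, -⟩ := reverseDualInsert_spec s.recording R 0 h.good.recTab
      (h.good.removable hch)
    refine ⟨i1, k1, k2.trans j2.symm, ?_, ?_⟩
    · rw [List.isChain_append]
      refine ⟨h.good.chain, by simp, fun p hp p' hp' => ?_⟩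
      obtain rfl : (col.1, (reverseDualInsert R s.recording).2) = p' := by simpa using hp'
      exact ⟨(h.good.arr_mem p (List.mem_of_mem_getLast? hp)).2.2, h.removed R hch p hp⟩
    · intro p hp
      rw [List.mem_append, List.mem_singleton] at hp
      rcases hp with hp | rfl
      · exact h.good.arr_mem p hp
      · exact ⟨k3.1, k3.2, le_rfl⟩

/-- The two clauses of `Ready` describe a block with fixed top entry: an addition is possible only
before any removal of the block and strictly below its earlier additions, and a removal must not
bump out less than the one before it. The comparison of consecutive insertions carries both along.
-/
theorem Ready.next {s : State m n} {col col' : ℕ × Letter m n} (h : Ready q s col)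
    (h1 : 1 ≤ col.1) (hq : col.1 ≤ q) (hle : col.1 ≤ col'.1)
    (heq : col.1 = col'.1 → ColRel (2 * m) col'.2.code col.2.code) :
    Ready q (step s col) col' := by
  have hg := h.good_step h1 hq
  rcases hle.eq_or_lt with he | hlt
  · have hC := heq he
    rcases hch : (spoInsert s.spo col.2).2 with R | R
    · have hs := step_of_added hch
      refine ⟨hg.mono hle, fun R' hR' => ?_, fun R' hR' p hp hpe => ?_⟩
      · rw [hs] at hR' ⊢
        have hlt := insertFrom_added_added s.spo 0 R R' col.2 col'.2 h.good.tab
          (admissible_zero _) hC hch hR'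
        obtain ⟨a1, a2⟩ := h.added R hch
        rw [← he]
        exact ⟨a1, fun r hr row hrow => a2 r (by omega) row
          (addBox_getElem? _ R r (by omega) hrow)⟩
      · rw [hs] at hp
        have := (h.added R hch).1 p (List.mem_of_mem_getLast? hp)
        omega
    · have hs := step_of_removed hch
      obtain ⟨R₁, hR₁, hrem⟩ := insertFrom_removed_removed s.spo 0 R col.2 col'.2 h.good.tab
        (admissible_zero _) hC hch
      have hrem' : (spoInsert (step s col).spo col'.2).2 = Change.removed R₁ := by
        rw [hs]; exact hrem
      have hr' := hg.removable hrem'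
      refine ⟨hg.mono hle, fun R' hR' => ?_, fun R' hR' p hp hpe => ?_⟩
      · rw [hrem'] at hR'
        simp at hR'
      · obtain rfl : R₁ = R' := by
          rw [hrem'] at hR'
          simpa using hR'
        rw [hs] at hp hr' ⊢
        obtain rfl : (col.1, (reverseDualInsert R s.recording).2) = p := by simpa using hp
        exact reverseDualInsert_le s.recording R R₁ 0 hR₁ h.good.recTab (h.good.removable hch) hr'
  -- A new block begins: everything stored so far is bounded by the smaller top entry.
  · refine ⟨hg.mono hle, fun R' _ => ⟨fun p hp => ?_, fun r _ row hrow x hx => ?_⟩,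
      fun R' _ p hp hpe => ?_⟩
    · exact lt_of_le_of_lt (hg.arr_mem p hp).2.2 hlt
    · exact lt_of_le_of_lt (hg.recTab.of_mem _ 0 row (List.mem_of_getElem? hrow) x hx).2 hlt
    · have := (hg.arr_mem p (List.mem_of_mem_getLast? hp)).2.2
      omega

theorem good_foldl (π : List (ℕ × Letter m n)) : ∀ (s : State m n) (col : ℕ × Letter m n),
    (∀ p ∈ col :: π, 1 ≤ p.1 ∧ p.1 ≤ q) →
    (col :: π).IsChain (fun p p' => p.1 ≤ p'.1 ∧
      (p.1 = p'.1 → ColRel (2 * m) p'.2.code p.2.code)) →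
    Ready q s col → Good q q ((col :: π).foldl step s) := by
  induction π with
  | nil =>
    intro s col hb _ h
    have := hb col (by simp)
    exact (h.good_step this.1 this.2).mono this.2
  | cons col' π ih =>
    intro s col hb hch h
    have hc := hb col (by simp)
    rw [List.isChain_cons_cons] at hch
    exact ih (step s col) col' (fun p hp => hb p (List.mem_cons_of_mem _ hp)) hch.2
      (h.next hc.1 hc.2 hch.1.1 hch.1.2)

theorem isChain_colRel (π : List (ℕ × Letter m n)) :
    π.IsChain (fun p p' => p.1 ≤ p'.1 ∧ (p.1 = p'.1 → p'.2 ≤ p.2)) →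
    (∀ (a : ℕ) (b : Letter m n), b.inB0 = true → π.count (a, b) ≤ 1) →
    π.IsChain (fun p p' => p.1 ≤ p'.1 ∧
      (p.1 = p'.1 → ColRel (2 * m) p'.2.code p.2.code)) := by
  induction π with
  | nil => simp
  | cons p π ih =>
    intro h1 h2
    cases π with
    | nil => simp
    | cons p' π =>
      rw [List.isChain_cons_cons] at h1 ⊢
      refine ⟨⟨h1.1.1, fun he => ?_⟩, ih h1.2 fun a b hb =>
        (List.count_le_count_cons).trans (h2 a b hb)⟩
      have hle := Letter.le_iff_code.1 (h1.1.2 he)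
      rcases hle.lt_or_eq with hlt | heq
      · exact Or.inl hlt
      -- Equal neighbouring columns with a letter of `B₀` would be a forbidden repetition.
      · refine Or.inr ⟨heq, ?_⟩
        by_contra hlt
        have hpp : p' = p := Prod.ext he.symm (Letter.eq_iff_code.2 heq)
        subst hpp
        have := h2 p'.1 p'.2 ((Letter.inB0_iff _).2 (by omega))
        simp at this

theorem good_run {π : List (ℕ × Letter m n)} (h : IsDualArray q π) : Good q q (run π) := by
  obtain ⟨h1, h2, h3⟩ := h
  have h0 : ∀ i, Good q i (⟨[], [], []⟩ : State m n) := fun i =>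
    ⟨trivial, trivial, rfl, by simp, by simp⟩
  cases π with
  | nil => exact h0 q
  | cons col π =>
    exact good_foldl π _ col h1 (isChain_colRel _ h2 h3) ⟨h0 _, by simp, by simp⟩

theorem isDualBurge_resort {L : List (ℕ × ℕ)} (h : ∀ p ∈ L, 1 ≤ p.2 ∧ p.2 ≤ p.1 ∧ p.1 ≤ q) :
    IsDualBurge q (resort L) := by
  have hmem : ∀ p ∈ resort L, 1 ≤ p.2 ∧ p.2 ≤ p.1 ∧ p.1 ≤ q := fun p hp =>
    h p ((List.mem_insertionSort _).1 hp)
  refine ⟨fun p hp => ?_, ?_, fun p hp => (hmem p hp).2.1⟩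
  · have := hmem p hp
    omega
  · let r : ℕ × ℕ → ℕ × ℕ → Prop := fun p p' => p.1 < p'.1 ∨ (p.1 = p'.1 ∧ p'.2 ≤ p.2)
    have : Std.Total r := ⟨fun a b => by simp only [r]; omega⟩
    have : IsTrans (ℕ × ℕ) r := ⟨fun a b c => by simp only [r]; omega⟩
    have hs : (resort L).Pairwise r := List.pairwise_insertionSort r L
    refine hs.isChain.imp fun p p' hp => ?_
    simp only [r] at hp
    omega

end SpoDual

theorem mainTheorem4 (m n q : ℕ) (π : List (ℕ × SpoDual.Letter m n))
    (hπ : SpoDual.IsDualArray q π) :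
    (∃ lam : YoungDiagram,
      SpoDual.IsSpoTableau lam (SpoDual.dualSpo π).1 ∧
      (SpoDual.run π).recording.HasShape lam ∧
      SpoDual.IsSemistandard q lam.transpose (SpoDual.dualSpo π).2.1) ∧
    (SpoDual.run π).arr.IsChain
      (fun p p' => p.1 ≤ p'.1 ∧ (p.1 = p'.1 → p.2 ≤ p'.2)) ∧
    SpoDual.IsDualBurge q (SpoDual.dualSpo π).2.2 := by
  have h := SpoDual.good_run hπ
  obtain ⟨lam, hlam⟩ := h.tab.exists_hasShape
  have hrec : (SpoDual.run π).recording.HasShape lam := h.shape.trans hlam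
  exact ⟨⟨lam, SpoDual.IsLetterTab.isSpoTableau h.tab hlam, hrec,
    SpoDual.IsDualTab.isSemistandard_transpose h.recTab hrec⟩, h.chain,
    SpoDual.isDualBurge_resort h.arr_mem⟩
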